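/- **Setting.** Let $(X,d)$ be a metric space, $P\subseteq X$ a finite set of points to be clustered, $F\subseteq X$ a finite nonempty set of possible centers, $n=|P\cup F|$, $k\ge 1$ an integer and $0<\epsilon<1$. For $c\in X$ and a finite $O\subseteq X$ put $\mathrm{cost}_c(O)=\sum_{x\in O}d(x,c)$ and $\mathrm{cost}(O)=\min_{c\in F}\mathrm{cost}_c(O)$. For a $k$-tuple of centers $C=(c_1,\dots,c_k)$ and a partition $\mathbb O=\{O_1,\dots,O_k\}$ of $P$ into $k$ (possibly empty) parts let $\mathrm{cost}_C(\mathbb O)=\min_{\pi}\max_{j\in[k]}\mathrm{cost}_{c_j}(O_{\pi(j)})$, where $\pi$ ranges over the permutations of $[k]$; if $|F|\ge k$, let $\mathrm{cost}(\mathbb O)$ be the minimum of $\mathrm{cost}_C(\mathbb O)$ over all $k$-tuples $C$ of pairwise distinct elements of $F$. The model of computation is a randomized real RAM: the points of $P\cup F$ are numbered $0,\dots,n-1$ (in any order); $n,k,\epsilon$ are given; a query for the distance of two points, or for membership of a point in $P$ or in $F$, an arithmetic operation on (or comparison of) integers or reals, a memory access, and the choice of a uniformly random integer from $\{0,\dots,m\}$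 each take constant time. **Theorem.** There are a randomized algorithm (one fixed program) and a constant $c$ such that on every input $(P,F,k,\epsilon)$ as above the algorithm always halts within $c\,(k/\epsilon)^{ck}\cdot n=(k/\epsilon)^{O(k)}n$ steps and outputs a list $L$ of at most $c\,(k/\epsilon)^{ck}=(k/\epsilon)^{O(k)}$ $k$-tuples of centers from $F$ (repetitions within a tuple being allowed), such that for every partition $\mathbb P^*=\{P_1^*,\dots,P_k^*\}$ of $P$ the following holds. 1. With probability at least $1/2$ there is $C\in L$ with $$\mathrm{cost}_C(\mathbb P^*)\le(3+\epsilon)\max_{i\in[k]}\mathrm{cost}(P_i^*).$$ 2. If $|F|\ge k$, then with probability at least $1/2$ there is $C\in L$ consisting of $k$ distinct centers with $$\mathrm{cost}_C(\mathbb P^*)\le(3+\epsilon)\,\mathrm{cost}(\mathbb P^*).$$ In particular, if the $P_i^*$ have pairwise distinct optimal centers in $F$, then with probability at least $1/2$ some $C\in L$ consisting of $k$ distinct centers satisfies the inequality of part 1. -/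

import Mathlib

/-! ## Clustering costs

All minima and maxima below range over finite families; they are nonempty as soon as there is a
facility and `0 < k` (and, for `optClusteringCost`, at least `k` facilities), so that `⨅` and `⨆`
are honest minima and maxima. -/

namespace MinLoad

/-- The sum-of-distances cost of the cluster `O` with centre `c`. -/
noncomputable def clusterCost {X : Type*} [MetricSpace X] (c : X) (O : Finset X) : ℝ :=
  ∑ x ∈ O, dist x c

/-- The cost of the cluster `O` with the best centre in `F`. -/
noncomputable def optClusterCost {X : Type*} [MetricSpace X] (F O : Finset X) : ℝ :=
  ⨅ c : {c // c ∈ F}, clusterCost c.1 O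

/-- The minimum-load cost of the clustering `O` with respect to the centres `C`, up to a
permutation of the clusters. -/
noncomputable def minLoadCost {X : Type*} [MetricSpace X] {k : ℕ} (C : Fin k → X)
    (O : Fin k → Finset X) : ℝ :=
  ⨅ π : Equiv.Perm (Fin k), ⨆ j : Fin k, clusterCost (C j) (O (π j))

/-- The optimal minimum-load cost of the clustering `O` over all sets of `k` (distinct) centres
in `F`. -/
noncomputable def optClusteringCost {X : Type*} [MetricSpace X] {k : ℕ} (F : Finset X)
    (O : Fin k → Finset X) : ℝ :=
  ⨅ C : {C : Fin k → X // Function.Injective C ∧ ∀ j, C j ∈ F}, minLoadCost C.1 O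

/-- `O 0, …, O (k-1)` are pairwise disjoint with union `P`; parts may be empty. -/
def IsPartition {X : Type*} {k : ℕ} (P : Finset X) (O : Fin k → Finset X) : Prop :=
  (∀ i j, i ≠ j → Disjoint (O i) (O j)) ∧ ∀ x, x ∈ P ↔ ∃ i, x ∈ O i

/-! ## A randomized real RAM with a distance oracle

Programs are finite texts of a structured language over integer and real variables and
unboundedly long integer and real arrays. Integers can be added, subtracted and compared; reals
can be added, subtracted, multiplied, divided and compared. The only constants are natural
numbers. One unit of time is one transition of the machine: one assignment, one array write, one
random draw, or one control step. A transition evaluates expressions that occur in the program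
text, so it performs a number of elementary operations bounded by a constant of the program. -/

/-- Read-only input: points are numbered, one query gives the distance of two points, or tells
whether a point is a client or a facility. -/
structure Oracle where
  dist : ℕ → ℕ → ℝ
  isClient : ℕ → Prop
  isFacility : ℕ → Prop

/-- Memory contents; the first argument of an array is its name, the second the index. -/
structure State where
  nvar : ℕ → ℕ
  narr : ℕ → ℕ → ℕ
  rvar : ℕ → ℝ
  rarr : ℕ → ℕ → ℝ

/-- Integer expressions. -/
inductive NExp where
  | lit (m : ℕ)
  | var (x : ℕ)
  | arr (a : ℕ) (i : NExp)
  | add (e f : NExp)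
  | sub (e f : NExp)

/-- Real expressions; `dist i j` queries the distance of the points numbered `i` and `j`. -/
inductive RExp where
  | ofNat (e : NExp)
  | var (x : ℕ)
  | arr (a : ℕ) (i : NExp)
  | add (e f : RExp)
  | sub (e f : RExp)
  | mul (e f : RExp)
  | div (e f : RExp)
  | dist (i j : NExp)

/-- Tests. -/
inductive BExp where
  | natLt (e f : NExp)
  | realLt (e f : RExp)
  | isClient (i : NExp)
  | isFacility (i : NExp)
  | not (b : BExp)
  | and (b c : BExp)

/-- Programs. -/
inductive Prog where
  | setN (x : ℕ) (e : NExp)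
  | setR (x : ℕ) (e : RExp)
  | writeN (a : ℕ) (i e : NExp)
  | writeR (a : ℕ) (i : NExp) (e : RExp)
  /-- store a uniformly random element of `{0, …, e}` in the integer variable `x` -/
  | rand (x : ℕ) (e : NExp)
  | seq (p q : Prog)
  | ite (b : BExp) (p q : Prog)
  | while (b : BExp) (p : Prog)

/-- Value of an integer expression (subtraction is truncated at `0`). -/
def NExp.eval (σ : State) : NExp → ℕ
  | .lit m => m
  | .var x => σ.nvar x
  | .arr a i => σ.narr a (i.eval σ)
  | .add e f => e.eval σ + f.eval σ
  | .sub e f => e.eval σ - f.eval σ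

/-- Value of a real expression (division by `0` gives `0`). -/
noncomputable def RExp.eval (O : Oracle) (σ : State) : RExp → ℝ
  | .ofNat e => (e.eval σ : ℝ)
  | .var x => σ.rvar x
  | .arr a i => σ.rarr a (i.eval σ)
  | .add e f => e.eval O σ + f.eval O σ
  | .sub e f => e.eval O σ - f.eval O σ
  | .mul e f => e.eval O σ * f.eval O σ
  | .div e f => e.eval O σ / f.eval O σ
  | .dist i j => O.dist (i.eval σ) (j.eval σ)

/-- Truth of a test. -/
def BExp.Holds (O : Oracle) (σ : State) : BExp → Prop
  | .natLt e f => e.eval σ < f.eval σ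
  | .realLt e f => e.eval O σ < f.eval O σ
  | .isClient i => O.isClient (i.eval σ)
  | .isFacility i => O.isFacility (i.eval σ)
  | .not b => ¬ b.Holds O σ
  | .and b c => b.Holds O σ ∧ c.Holds O σ

/-- Assignment to an integer variable. -/
def State.setN (σ : State) (x v : ℕ) : State :=
  { σ with nvar := Function.update σ.nvar x v }

/-- Assignment to a real variable. -/
def State.setR (σ : State) (x : ℕ) (v : ℝ) : State :=
  { σ with rvar := Function.update σ.rvar x v }

/-- Write into an integer array. -/
def State.writeN (σ : State) (a i v : ℕ) : State :=
  { σ with narr := Function.update σ.narr a (Function.update (σ.narr a) i v) }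

/-- Write into a real array. -/
def State.writeR (σ : State) (a i : ℕ) (v : ℝ) : State :=
  { σ with rarr := Function.update σ.rarr a (Function.update (σ.rarr a) i v) }

/-- A configuration: the stack of programs still to be executed, and the memory. The machine has
halted when the stack is empty. -/
abbrev Config := List Prog × State

open Classical in
/-- One transition (one unit of time), as a probability distribution on the next configuration. -/
noncomputable def step (O : Oracle) : Config → PMF Config
  | ([], σ) => PMF.pure ([], σ)
  | (.setN x e :: K, σ) => PMF.pure (K, σ.setN x (e.eval σ))
  | (.setR x e :: K, σ) => PMF.pure (K, σ.setR x (e.eval O σ))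
  | (.writeN a i e :: K, σ) => PMF.pure (K, σ.writeN a (i.eval σ) (e.eval σ))
  | (.writeR a i e :: K, σ) => PMF.pure (K, σ.writeR a (i.eval σ) (e.eval O σ))
  | (.rand x e :: K, σ) =>
      (PMF.uniformOfFintype (Fin (e.eval σ + 1))).map fun v => (K, σ.setN x v)
  | (.seq p q :: K, σ) => PMF.pure (p :: q :: K, σ)
  | (.ite b p q :: K, σ) => PMF.pure ((if b.Holds O σ then p else q) :: K, σ)
  | (.while b p :: K, σ) =>
      PMF.pure (if b.Holds O σ then p :: .while b p :: K else K, σ)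

/-- Distribution of the configuration after `T` units of time. -/
noncomputable def run (O : Oracle) : ℕ → Config → PMF Config
  | 0, cfg => PMF.pure cfg
  | T + 1, cfg => (step O cfg).bind (run O T)

/-- Initially the integer variables `0`, `1` hold `n`, `k`, the real variable `0` holds `ε`, and
everything else is zero. -/
noncomputable def initState (n k : ℕ) (ε : ℝ) : State where
  nvar := fun x => if x = 0 then n else if x = 1 then k else 0
  narr := fun _ _ => 0
  rvar := fun x => if x = 0 then ε else 0
  rarr := fun _ _ => 0

/-- The oracle of the input with clients `P` and facilities `F`, the points of `P ∪ F` being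
numbered by `pts`. Numbers out of range give distance `0` and belong to neither set. -/
noncomputable def inputOracle {X : Type*} [MetricSpace X] [DecidableEq X] (P F : Finset X)
    (pts : Fin (P ∪ F).card ≃ {x // x ∈ P ∪ F}) : Oracle where
  dist := fun i j =>
    if h : i < (P ∪ F).card ∧ j < (P ∪ F).card then
      dist (pts ⟨i, h.1⟩ : X) (pts ⟨j, h.2⟩ : X)
    else 0
  isClient := fun i => ∃ h : i < (P ∪ F).card, (pts ⟨i, h⟩ : X) ∈ P
  isFacility := fun i => ∃ h : i < (P ∪ F).card, (pts ⟨i, h⟩ : X) ∈ F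

/-- Distribution of the configuration `T` time units after starting `prog` on the input
`(P, F, k, ε)`. -/
noncomputable def runInput {X : Type*} [MetricSpace X] [DecidableEq X] (prog : Prog)
    (P F : Finset X) (pts : Fin (P ∪ F).card ≃ {x // x ∈ P ∪ F}) (k : ℕ) (ε : ℝ) (T : ℕ) :
    PMF Config :=
  run (inputOracle P F pts) T ([prog], initState (P ∪ F).card k ε)

/-- The memory `σ` holds the list `L` of `k`-tuples of points: integer variable `2` is the length
of the list, and integer array `0` holds the numbers of the points, tuple after tuple. -/
def Encodes {X : Type*} [DecidableEq X] {P F : Finset X}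
    (pts : Fin (P ∪ F).card ≃ {x // x ∈ P ∪ F}) {k : ℕ} (σ : State) (L : List (Fin k → X)) :
    Prop :=
  σ.nvar 2 = L.length ∧
    ∀ (t : ℕ) (ht : t < L.length) (j : Fin k),
      ∃ h : σ.narr 0 (t * k + j) < (P ∪ F).card,
        (pts ⟨σ.narr 0 (t * k + j), h⟩ : X) = L[t] j

end MinLoad

/-! The algorithm samples by distance. From one arbitrary point it makes `numRounds k ε` =
⌈4608k²/ε²⌉ further draws; a client is drawn with probability nearly proportional to its distance
from the sample so far. It then takes k nearest facilities of every sample point as candidates and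
outputs all k-tuples of candidates.

Fix a partition O, centres c_i whose costs z_i are all at most M, and η = ε/4. A point s serves
cluster i if |O_i| d(s,c_i) ≤ (1+η)z_i + ηM. A facility at most as far from s as c_i is within
2d(s,c_i) of c_i, so as a centre it costs at most z_i + 2|O_i|d(s,c_i) ≤ (3+4η)M = (3+ε)M
(`clusterCost_le_of_serves`). Thus the output is good once every cluster is served by some sample
point.

In an unserved cluster, the points whose distance to the centre is hardly above average (the core)
are an η/3 fraction by Markov's inequality, and all of them are far from the sample. So the core
carries a share of order η² of the distance sum of its cluster, and at least η²M/3 (`sum_le_core`),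
while a served cluster has distance sum at most 4M (`sum_le_of_serves`). Hence the cores of the
unserved clusters carry at least η²/(36k) of the total (`exists_progress`), and each of their points
serves its cluster. Drawing integers instead of reals loses at most half of this share
(`card_selected`).

With u clusters unserved and j rounds left, 2^u β^j for β = 1 - η²/(144k), replaced by 0 when u = 0,
does not increase in expectation (`sum_failBound_le`). It is at least 1 after a failure and at most
1/2 at the start (`failBound_numRounds_le`), which bounds the failure probability.

For distinct centres, Hall's theorem selects distinct candidates (`exists_injective_candidates`): a
missing centre leaves k distinct facilities that are at least as near.

The program is verified by total correctness triples with time bounds (`Ex`) for its deterministic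
parts and by lower bounds on probabilities (`Likely`) around the random draws. The two meet in
`likely_sampling` and `likely_program`. -/

namespace MinLoad

/-! ## Big-step semantics of the deterministic part of the language -/

/-- `Big O p σ t σ'`: the program `p`, started in memory `σ`, halts after exactly `t` transitions
in memory `σ'`, without drawing random numbers. -/
inductive Big (O : Oracle) : Prog → State → ℕ → State → Prop where
  | setN (x e σ) : Big O (.setN x e) σ 1 (σ.setN x (e.eval σ))
  | setR (x e σ) : Big O (.setR x e) σ 1 (σ.setR x (e.eval O σ))
  | writeN (a i e σ) : Big O (.writeN a i e) σ 1 (σ.writeN a (i.eval σ) (e.eval σ))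
  | writeR (a i e σ) : Big O (.writeR a i e) σ 1 (σ.writeR a (i.eval σ) (e.eval O σ))
  | seq {p q σ s σ₁ t σ₂} : Big O p σ s σ₁ → Big O q σ₁ t σ₂ → Big O (.seq p q) σ (s + t + 1) σ₂
  | ite_true {b p q σ t σ'} : b.Holds O σ → Big O p σ t σ' → Big O (.ite b p q) σ (t + 1) σ'
  | ite_false {b p q σ t σ'} : ¬ b.Holds O σ → Big O q σ t σ' → Big O (.ite b p q) σ (t + 1) σ'
  | while_true {b p σ s σ₁ t σ₂} : b.Holds O σ → Big O p σ s σ₁ →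
      Big O (.while b p) σ₁ t σ₂ → Big O (.while b p) σ (s + t + 1) σ₂
  | while_false {b p σ} : ¬ b.Holds O σ → Big O (.while b p) σ 1 σ

/-- The continuation `K` and the remaining time `T` must be arbitrary: sequencing and loops run a
subprogram with more programs waiting below it on the stack. -/
theorem Big.run_eq {O : Oracle} {p : Prog} {σ σ' : State} {t : ℕ} (h : Big O p σ t σ') :
    ∀ (K : List Prog) (T : ℕ), run O (T + t) (p :: K, σ) = run O T (K, σ') := by
  induction h with
  | setN | setR | writeN | writeR => intro K T; simp [run, step, PMF.pure_bind]
  | seq _ _ ih₁ ih₂ =>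
    intro K T
    rw [← add_assoc, run, step, PMF.pure_bind, add_comm _ (_ : ℕ), ← ih₂, ← ih₁]
    congr 1; omega
  | ite_true hb _ ih =>
    intro K T
    rw [← add_assoc, run, step, PMF.pure_bind, if_pos hb, ih]
  | ite_false hb _ ih =>
    intro K T
    rw [← add_assoc, run, step, PMF.pure_bind, if_neg hb, ih]
  | while_true hb _ _ ih₁ ih₂ =>
    intro K T
    rw [← add_assoc, run, step, PMF.pure_bind, if_pos hb, ← ih₂, ← ih₁]
    congr 1; omega
  | while_false hb =>
    intro K T
    rw [run, step, PMF.pure_bind, if_neg hb]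

/-! ### Variables a program may change -/

/-- `p` may assign to the integer variable `x`. -/
def Prog.wN (x : ℕ) : Prog → Bool
  | .setN y _ => x == y
  | .rand y _ => x == y
  | .seq p q => p.wN x || q.wN x
  | .ite _ p q => p.wN x || q.wN x
  | .while _ p => p.wN x
  | _ => false

/-- `p` may assign to the real variable `x`. -/
def Prog.wR (x : ℕ) : Prog → Bool
  | .setR y _ => x == y
  | .seq p q => p.wR x || q.wR x
  | .ite _ p q => p.wR x || q.wR x
  | .while _ p => p.wR x
  | _ => false

/-- `p` may write into the integer array `a`. -/
def Prog.wNA (a : ℕ) : Prog → Bool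
  | .writeN b _ _ => a == b
  | .seq p q => p.wNA a || q.wNA a
  | .ite _ p q => p.wNA a || q.wNA a
  | .while _ p => p.wNA a
  | _ => false

/-- `p` may write into the real array `a`. -/
def Prog.wRA (a : ℕ) : Prog → Bool
  | .writeR b _ _ => a == b
  | .seq p q => p.wRA a || q.wRA a
  | .ite _ p q => p.wRA a || q.wRA a
  | .while _ p => p.wRA a
  | _ => false

/-- `σ'` agrees with `σ` on everything that `p` does not write. -/
structure Frame (p : Prog) (σ σ' : State) : Prop where
  n : ∀ x, p.wN x = false → σ'.nvar x = σ.nvar x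
  r : ∀ x, p.wR x = false → σ'.rvar x = σ.rvar x
  na : ∀ a, p.wNA a = false → σ'.narr a = σ.narr a
  ra : ∀ a, p.wRA a = false → σ'.rarr a = σ.rarr a

theorem Frame.refl (p : Prog) (σ : State) : Frame p σ σ :=
  ⟨fun _ _ => rfl, fun _ _ => rfl, fun _ _ => rfl, fun _ _ => rfl⟩

theorem Frame.trans {p : Prog} {σ σ₁ σ₂ : State} (h : Frame p σ σ₁) (h' : Frame p σ₁ σ₂) :
    Frame p σ σ₂ :=
  ⟨fun x hx => (h'.n x hx).trans (h.n x hx), fun x hx => (h'.r x hx).trans (h.r x hx),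
    fun x hx => (h'.na x hx).trans (h.na x hx), fun x hx => (h'.ra x hx).trans (h.ra x hx)⟩

theorem Frame.mono {p q : Prog} {σ σ' : State} (h : Frame p σ σ')
    (hn : ∀ x, q.wN x = false → p.wN x = false) (hr : ∀ x, q.wR x = false → p.wR x = false)
    (hna : ∀ x, q.wNA x = false → p.wNA x = false)
    (hra : ∀ x, q.wRA x = false → p.wRA x = false) : Frame q σ σ' :=
  ⟨fun x hx => h.n x (hn x hx), fun x hx => h.r x (hr x hx), fun x hx => h.na x (hna x hx),
    fun x hx => h.ra x (hra x hx)⟩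

theorem Frame.seq_left {p q : Prog} {σ σ' : State} (h : Frame p σ σ') : Frame (.seq p q) σ σ' := by
  apply h.mono <;> · intro x hx; simp_all [Prog.wN, Prog.wR, Prog.wNA, Prog.wRA]

theorem Frame.seq_right {p q : Prog} {σ σ' : State} (h : Frame q σ σ') :
    Frame (.seq p q) σ σ' := by
  apply h.mono <;> · intro x hx; simp_all [Prog.wN, Prog.wR, Prog.wNA, Prog.wRA]

theorem Frame.while_body {b : BExp} {p : Prog} {σ σ' : State} (h : Frame p σ σ') :
    Frame (.while b p) σ σ' := by
  apply h.mono <;> · intro x hx; simp_all [Prog.wN, Prog.wR, Prog.wNA, Prog.wRA]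

theorem Big.frame {O : Oracle} {p : Prog} {σ σ' : State} {t : ℕ} (h : Big O p σ t σ') :
    Frame p σ σ' := by
  induction h with
  | setN => constructor <;> · intro x hx; simp_all [Prog.wN, State.setN]
  | setR => constructor <;> · intro x hx; simp_all [Prog.wR, State.setR]
  | writeN => constructor <;> · intro x hx; simp_all [Prog.wNA, State.writeN]
  | writeR => constructor <;> · intro x hx; simp_all [Prog.wRA, State.writeR]
  | seq _ _ ih₁ ih₂ => exact ih₁.seq_left.trans ih₂.seq_right
  | ite_true _ _ ih =>
    apply ih.mono <;> · intro x hx; simp_all [Prog.wN, Prog.wR, Prog.wNA, Prog.wRA]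
  | ite_false _ _ ih =>
    apply ih.mono <;> · intro x hx; simp_all [Prog.wN, Prog.wR, Prog.wNA, Prog.wRA]
  | while_true _ _ _ ih₁ ih₂ => exact ih₁.while_body.trans ih₂
  | while_false => exact Frame.refl _ _

/-! ### Total correctness with time bounds -/

/-- Started in `σ`, the program `p` halts within `t` transitions, in a memory satisfying `Q`. -/
def Ex (O : Oracle) (p : Prog) (σ : State) (t : ℕ) (Q : State → Prop) : Prop :=
  ∃ τ ≤ t, ∃ σ', Big O p σ τ σ' ∧ Q σ'

theorem Ex.mono {O : Oracle} {p : Prog} {σ : State} {s t : ℕ} {Q R : State → Prop}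
    (h : Ex O p σ s Q) (hst : s ≤ t) (hQR : ∀ σ', Frame p σ σ' → Q σ' → R σ') :
    Ex O p σ t R := by
  obtain ⟨τ, hτ, σ', hb, hQ⟩ := h
  exact ⟨τ, hτ.trans hst, σ', hb, hQR σ' hb.frame hQ⟩

theorem Ex.seq {O : Oracle} {p q : Prog} {σ : State} {s t : ℕ} {Q R : State → Prop}
    (h : Ex O p σ s Q) (h' : ∀ σ', Frame p σ σ' → Q σ' → Ex O q σ' t R) :
    Ex O (.seq p q) σ (s + t + 1) R := by
  obtain ⟨τ, hτ, σ₁, hb, hQ⟩ := h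
  obtain ⟨τ', hτ', σ₂, hb', hR⟩ := h' σ₁ hb.frame hQ
  exact ⟨τ + τ' + 1, by omega, σ₂, hb.seq hb', hR⟩

/-- The frame relative to `σ₀` is supplied in every iteration, so an invariant need only mention
what the loop changes. -/
theorem Ex.while_loop {O : Oracle} {b : BExp} {p : Prog} {σ₀ : State} {t : ℕ} (m : ℕ)
    (I : ℕ → State → Prop) (h₀ : I 0 σ₀)
    (hI : ∀ i < m, ∀ σ, Frame (.while b p) σ₀ σ → I i σ → b.Holds O σ ∧ Ex O p σ t (I (i + 1)))
    (hm : ∀ σ, Frame (.while b p) σ₀ σ → I m σ → ¬ b.Holds O σ) :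
    Ex O (.while b p) σ₀ (m * (t + 1) + 1) (I m) := by
  suffices H : ∀ j i, i + j = m → ∀ σ, Frame (.while b p) σ₀ σ → I i σ →
      Ex O (.while b p) σ (j * (t + 1) + 1) (I m) from
    H m 0 (by omega) σ₀ (Frame.refl _ _) h₀
  intro j
  induction j with
  | zero =>
    intro i hi σ hf h
    obtain rfl : i = m := by omega
    exact ⟨1, by omega, σ, .while_false (hm σ hf h), h⟩
  | succ j ih =>
    intro i hi σ hf h
    obtain ⟨hb, τ, hτ, σ₁, hB, h₁⟩ := hI i (by omega) σ hf h
    obtain ⟨τ', hτ', σ₂, hB', h₂⟩ := ih (i + 1) (by omega) σ₁ (hf.trans hB.frame.while_body) h₁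
    refine ⟨τ + τ' + 1, ?_, σ₂, .while_true hb hB hB', h₂⟩
    have : (j + 1) * (t + 1) = j * (t + 1) + t + 1 := by ring
    omega

/-- `for x in {0, …, (variable b) - 1} do p`. -/
def forLt (x b : ℕ) (p : Prog) : Prog :=
  .seq (.setN x (.lit 0))
    (.while (.natLt (.var x) (.var b)) (.seq p (.setN x (.add (.var x) (.lit 1)))))

/-- Per iteration, the body is accompanied by a test, a sequencing step and the increment; the final
`+ 3` pays for the initial assignment, the outer sequencing and the failing test. -/
theorem Ex.forLt {O : Oracle} {x b : ℕ} {p : Prog} {σ₀ : State} {t : ℕ}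
    (hx : p.wN x = false) (hb : p.wN b = false) (hxb : b ≠ x) (m : ℕ) (hm : σ₀.nvar b = m)
    (I : ℕ → State → Prop) (h₀ : I 0 (σ₀.setN x 0))
    (hI : ∀ i < m, ∀ σ, Frame (forLt x b p) σ₀ σ → σ.nvar x = i → I i σ →
      Ex O p σ t (fun σ' => I (i + 1) (σ'.setN x (i + 1)))) :
    Ex O (forLt x b p) σ₀ (m * (t + 3) + 3) (I m) := by
  have h1 : Ex O (.setN x (.lit 0)) σ₀ 1 (fun σ => σ = σ₀.setN x 0) :=
    ⟨1, le_rfl, _, .setN _ _ _, rfl⟩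
  refine (h1.seq (t := m * (t + 3) + 1) (R := I m) ?_).mono (by omega) (fun _ _ h => h)
  rintro σ' hf' rfl
  refine (Ex.while_loop (t := t + 2) m (fun i σ => σ.nvar x = i ∧ I i σ) ⟨by simp [State.setN], h₀⟩
    ?_ ?_).mono (by ring_nf; omega) (fun _ _ h => h.2)
  · rintro i hi σ hf ⟨hxi, h⟩
    have hF : Frame (MinLoad.forLt x b p) σ₀ σ := hf'.seq_left.trans hf.seq_right
    have hbm : σ.nvar b = m := by
      rw [hF.n b (by simp [MinLoad.forLt, Prog.wN, hb, hxb]), hm]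
    refine ⟨by simpa [BExp.Holds, NExp.eval, hxi, hbm] using hi, ?_⟩
    refine ((hI i hi σ hF hxi h).seq (t := 1) (R := fun σ => σ.nvar x = i + 1 ∧ I (i + 1) σ)
      ?_).mono (by omega) (fun _ _ h => h)
    intro σ₁ hf₁ h₁
    have hx₁ : σ₁.nvar x = i := by rw [hf₁.n x hx, hxi]
    refine ⟨1, le_rfl, _, .setN _ _ _, ?_⟩
    simp only [NExp.eval, hx₁]
    exact ⟨by simp [State.setN], h₁⟩
  · rintro σ hf ⟨hxi, -⟩
    have hF : Frame (MinLoad.forLt x b p) σ₀ σ := hf'.seq_left.trans hf.seq_right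
    have hbm : σ.nvar b = m := by
      rw [hF.n b (by simp [MinLoad.forLt, Prog.wN, hb, hxb]), hm]
    simp [BExp.Holds, NExp.eval, hxi, hbm]

/-! ### Straight-line programs -/

open Classical in
/-- The memory after executing a program without loops and random draws. -/
noncomputable def Prog.exec (O : Oracle) : Prog → State → State
  | .setN x e, σ => σ.setN x (e.eval σ)
  | .setR x e, σ => σ.setR x (e.eval O σ)
  | .writeN a i e, σ => σ.writeN a (i.eval σ) (e.eval σ)
  | .writeR a i e, σ => σ.writeR a (i.eval σ) (e.eval O σ)
  | .seq p q, σ => q.exec O (p.exec O σ)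
  | .ite b p q, σ => if b.Holds O σ then p.exec O σ else q.exec O σ
  | _, σ => σ

/-- The program has no loops and no random draws. -/
def Prog.straight : Prog → Bool
  | .seq p q => p.straight && q.straight
  | .ite _ p q => p.straight && q.straight
  | .while _ _ => false
  | .rand _ _ => false
  | _ => true

/-- A bound for the running time of a program without loops. -/
def Prog.len : Prog → ℕ
  | .seq p q => p.len + q.len + 1
  | .ite _ p q => p.len + q.len + 1
  | _ => 1

theorem Ex.straight {O : Oracle} (p : Prog) (hp : p.straight = true) (σ : State)
    {Q : State → Prop} (hQ : Q (p.exec O σ)) {t : ℕ} (ht : p.len ≤ t) : Ex O p σ t Q := by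
  suffices H : ∀ σ, Ex O p σ p.len (fun σ' => σ' = p.exec O σ) from
    (H σ).mono ht (fun _ _ h => h ▸ hQ)
  clear hQ ht
  induction p with
  | setN | setR | writeN | writeR => intro σ; exact ⟨1, le_rfl, _, by constructor, rfl⟩
  | seq p q ihp ihq =>
    intro σ
    simp only [Prog.straight, Bool.and_eq_true] at hp
    refine (ihp hp.1 σ).seq ?_
    rintro σ' - rfl
    exact ihq hp.2 _
  | ite b p q ihp ihq =>
    intro σ
    simp only [Prog.straight, Bool.and_eq_true] at hp
    by_cases hb : b.Holds O σ
    · obtain ⟨τ, hτ, σ', hB, h⟩ := ihp hp.1 σ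
      exact ⟨τ + 1, by simp only [Prog.len]; omega, σ', .ite_true hb hB, by simp [Prog.exec, hb, h]⟩
    · obtain ⟨τ, hτ, σ', hB, h⟩ := ihq hp.2 σ
      exact ⟨τ + 1, by simp only [Prog.len]; omega, σ', .ite_false hb hB, by simp [Prog.exec, hb, h]⟩
  | _ => simp [Prog.straight] at hp

/-! ### Probabilities of events -/

/-- The probability that after `T` transitions from `cfg` the event `S` holds. -/
noncomputable def prob (O : Oracle) (S : Set Config) (T : ℕ) (cfg : Config) : ℝ :=
  ((run O T cfg).toOuterMeasure S).toReal

/-- From time `t` on, the event `S` holds with probability at least `q`. -/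
def Likely (O : Oracle) (S : Set Config) (t : ℕ) (cfg : Config) (q : ℝ) : Prop :=
  ∀ T ≥ t, q ≤ prob O S T cfg

theorem Likely.mono {O : Oracle} {S : Set Config} {s t : ℕ} {cfg : Config} {q r : ℝ}
    (h : Likely O S s cfg q) (hst : s ≤ t) (hrq : r ≤ q) : Likely O S t cfg r :=
  fun T hT => hrq.trans (h T (hst.trans hT))

theorem toOuterMeasure_le_one {α : Type*} (p : PMF α) (S : Set α) : p.toOuterMeasure S ≤ 1 := by
  classical
  rw [PMF.toOuterMeasure_apply]
  calc ∑' x, S.indicator p x ≤ ∑' x, p x :=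
        ENNReal.tsum_le_tsum fun x => Set.indicator_le_self _ _ x
    _ = 1 := p.tsum_coe

theorem prob_nonneg (O : Oracle) (S : Set Config) (T : ℕ) (cfg : Config) : 0 ≤ prob O S T cfg :=
  ENNReal.toReal_nonneg

theorem run_halted (O : Oracle) (T : ℕ) (σ : State) : run O T ([], σ) = PMF.pure ([], σ) := by
  induction T with
  | zero => rfl
  | succ T ih => rw [run, step, PMF.pure_bind, ih]

theorem Likely.halted {O : Oracle} {S : Set Config} {σ : State} (h : (([], σ) : Config) ∈ S)
    (t : ℕ) : Likely O S t ([], σ) 1 := by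
  intro T _
  classical
  simp [prob, run_halted, PMF.toOuterMeasure_pure_apply, h]

theorem Likely.big {O : Oracle} {S : Set Config} {p : Prog} {σ σ' : State} {τ t : ℕ}
    {K : List Prog} {q : ℝ} (hB : Big O p σ τ σ') (h : Likely O S t (K, σ') q) :
    Likely O S (t + τ) (p :: K, σ) q := by
  intro T hT
  obtain ⟨T', rfl⟩ : ∃ T', T = T' + τ := ⟨T - τ, by omega⟩
  rw [prob, hB.run_eq]
  exact h T' (by omega)

theorem Likely.ex {O : Oracle} {S : Set Config} {p : Prog} {σ : State} {s t : ℕ}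
    {K : List Prog} {q : ℝ} {Q : State → Prop} (hE : Ex O p σ s Q)
    (h : ∀ σ', Frame p σ σ' → Q σ' → Likely O S t (K, σ') q) :
    Likely O S (s + t) (p :: K, σ) q := by
  obtain ⟨τ, hτ, σ', hB, hQ⟩ := hE
  exact (Likely.big hB (h σ' hB.frame hQ)).mono (by omega) le_rfl

theorem Likely.seq {O : Oracle} {S : Set Config} {p p' : Prog} {σ : State} {t : ℕ}
    {K : List Prog} {q : ℝ} (h : Likely O S t (p :: p' :: K, σ) q) :
    Likely O S (t + 1) (.seq p p' :: K, σ) q := by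
  intro T hT
  obtain ⟨T', rfl⟩ : ∃ T', T = T' + 1 := ⟨T - 1, by omega⟩
  rw [prob, run, step, PMF.pure_bind]
  exact h T' (by omega)

theorem Likely.while_true {O : Oracle} {S : Set Config} {b : BExp} {p : Prog} {σ : State} {t : ℕ}
    {K : List Prog} {q : ℝ} (hb : b.Holds O σ) (h : Likely O S t (p :: .while b p :: K, σ) q) :
    Likely O S (t + 1) (.while b p :: K, σ) q := by
  intro T hT
  obtain ⟨T', rfl⟩ : ∃ T', T = T' + 1 := ⟨T - 1, by omega⟩
  rw [prob, run, step, PMF.pure_bind, if_pos hb]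
  exact h T' (by omega)

theorem Likely.while_false {O : Oracle} {S : Set Config} {b : BExp} {p : Prog} {σ : State} {t : ℕ}
    {K : List Prog} {q : ℝ} (hb : ¬ b.Holds O σ) (h : Likely O S t (K, σ) q) :
    Likely O S (t + 1) (.while b p :: K, σ) q := by
  exact Likely.big (.while_false hb) h

theorem prob_rand (O : Oracle) (S : Set Config) (x : ℕ) (e : NExp) (K : List Prog) (σ : State)
    (T : ℕ) : prob O S (T + 1) (.rand x e :: K, σ) =
      (∑ v : Fin (e.eval σ + 1), prob O S T (K, σ.setN x v)) / (e.eval σ + 1 : ℕ) := by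
  have hstep : run O (T + 1) (.rand x e :: K, σ) =
      (PMF.uniformOfFintype (Fin (e.eval σ + 1))).bind fun v => run O T (K, σ.setN x v) := by
    -- The draw from `Fin` is cast to `ℕ` inside the monad before being stored; this form exposes
    -- the cast as a `bind` with `pure`.
    change (PMF.map _ ((PMF.uniformOfFintype (Fin (e.eval σ + 1))).bind
      fun a => PMF.pure (a : ℕ))).bind (run O T) = _
    rw [PMF.bind_map, PMF.bind_bind]
    simp only [PMF.pure_bind, Function.comp_apply]
  rw [prob, hstep, PMF.toOuterMeasure_bind_apply, tsum_fintype,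
    ENNReal.toReal_sum, Finset.sum_div]
  · refine Finset.sum_congr rfl fun v _ => ?_
    simp [prob, ENNReal.toReal_mul, div_eq_inv_mul, ENNReal.toReal_inv]
    left
    rw [ENNReal.toReal_add (by simp) (by simp)]; simp
  · intro v _
    refine ENNReal.mul_ne_top (PMF.apply_ne_top _ _) ?_
    exact ne_top_of_le_ne_top ENNReal.one_ne_top (toOuterMeasure_le_one _ _)

theorem Likely.rand {O : Oracle} {S : Set Config} {x : ℕ} {e : NExp} {σ : State} {t m : ℕ}
    {K : List Prog} (hm : e.eval σ = m) (q : ℕ → ℝ)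
    (h : ∀ v ≤ m, Likely O S t (K, σ.setN x v) (q v)) :
    Likely O S (t + 1) (.rand x e :: K, σ) ((∑ v ∈ Finset.range (m + 1), q v) / (m + 1 : ℕ)) := by
  subst hm
  intro T hT
  obtain ⟨T', rfl⟩ : ∃ T', T = T' + 1 := ⟨T - 1, by omega⟩
  rw [prob_rand, Finset.sum_range]
  gcongr with v
  exact h v (by omega) T' (by omega)

/-- This turns probability one into a worst-case guarantee for every outcome of the random draws. -/
theorem support_subset_of_likely {O : Oracle} {S : Set Config} {T : ℕ} {cfg : Config}
    (h : Likely O S T cfg 1) : (run O T cfg).support ⊆ S := by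
  rw [← PMF.toOuterMeasure_apply_eq_one_iff]
  have h1 := h T le_rfl
  refine le_antisymm (toOuterMeasure_le_one _ _) ?_
  rw [prob] at h1
  exact (ENNReal.one_le_ofReal.2 h1).trans ENNReal.ofReal_toReal_le

theorem half_le_of_likely {O : Oracle} {S : Set Config} {T : ℕ} {cfg : Config}
    (h : Likely O S T cfg (1 / 2)) : 1 / 2 ≤ (run O T cfg).toOuterMeasure S := by
  have h1 := h T le_rfl
  rw [prob] at h1
  calc (1 / 2 : ENNReal) = ENNReal.ofReal (1 / 2) := by
        rw [ENNReal.ofReal_div_of_pos (by norm_num)]; simp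
    _ ≤ ENNReal.ofReal ((run O T cfg).toOuterMeasure S).toReal := ENNReal.ofReal_le_ofReal h1
    _ ≤ _ := ENNReal.ofReal_toReal_le

/-! ## The program

Integer variables: `0` number of points, `1` number of clusters, `2` length of the output list,
`3` number of rounds, `4` bound for the random draws, `5` current point, `6` current round or
sample, `7` latest sample, `8` random number, `9` counter, `10` number of candidates, `11` nearest
unmarked facility, `12` flag, `13` number of clusters minus one, `14` and `16` write and read
positions in the output, `15` current candidate, `17` counter, `18` number of samples, `19` unused.

Integer arrays: `0` output, `1` samples, `2` candidates, `3` marks of facilities. The real array `0`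
holds the distances of the clients to the samples. The real variables `1`, `2`, `3` hold the total
of these distances, their partial sums, and the length of the output list. -/

/-- No operation. -/
def skip : Prog := .setN 19 (.lit 0)

/-- Compute the number of sampling rounds. -/
def countRounds : Prog :=
  .while (.realLt (.mul (.ofNat (.var 3)) (.mul (.var 0) (.var 0)))
      (.mul (.ofNat (.lit 4608)) (.mul (.ofNat (.var 1)) (.ofNat (.var 1)))))
    (.setN 3 (.add (.var 3) (.lit 1)))

/-- Compute the bound for the random draws. -/
def computeBound : Prog := forLt 5 0 (.setN 4 (.add (.var 4) (.var 3)))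

/-- Initialize the distances of the clients with those to point `0`, the first sample. -/
def initDist : Prog :=
  forLt 5 0 (.ite (.isClient (.var 5)) (.writeR 0 (.var 5) (.dist (.var 5) (.lit 0))) skip)

/-- Everything before the first round. -/
def setup : Prog := .seq countRounds (.seq computeBound initDist)

/-- Update the distances to the samples and their total with the latest sample. -/
def updateDist : Prog :=
  .seq (.setR 1 (.ofNat (.lit 0)))
    (forLt 5 0 (.seq
      (.ite (.realLt (.dist (.var 5) (.var 7)) (.arr 0 (.var 5)))
        (.writeR 0 (.var 5) (.dist (.var 5) (.var 7))) skip)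
      (.setR 1 (.add (.var 1) (.arr 0 (.var 5))))))

/-- Scan the partial sums of the distances for the point selected by the random number. -/
def scanSums : Prog :=
  forLt 5 0 (.seq
    (.ite (.realLt (.mul (.ofNat (.var 8)) (.var 1))
        (.mul (.ofNat (.add (.var 4) (.lit 1))) (.var 2))) skip (.setN 7 (.var 5)))
    (.setR 2 (.add (.var 2) (.arr 0 (.var 5)))))

/-- Select the next sample by the random number and record it. -/
def selectSample : Prog :=
  .seq (.seq (.setN 7 (.lit 0)) (.setR 2 (.ofNat (.lit 0))))
    (.seq scanSums
      (.seq (.setN 6 (.add (.var 6) (.lit 1))) (.writeN 1 (.var 6) (.var 7))))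

/-- One sampling round. -/
def round : Prog := .seq updateDist (.seq (.rand 8 (.var 4)) selectSample)

/-- Find an unmarked facility nearest to the sample numbered by variable `6`, if there is one. -/
def findNearest : Prog :=
  .seq (.setN 12 (.lit 0))
    (forLt 5 0 (.ite (.and (.isFacility (.var 5))
        (.and (.natLt (.arr 3 (.var 5)) (.add (.var 6) (.lit 1)))
          (.not (.and (.natLt (.lit 0) (.var 12))
            (.not (.realLt (.dist (.var 5) (.arr 1 (.var 6)))
              (.dist (.var 11) (.arr 1 (.var 6)))))))))
      (.seq (.setN 11 (.var 5)) (.setN 12 (.lit 1))) skip))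

/-- Record the facility found as a candidate and mark it. -/
def record : Prog :=
  .seq (.writeN 2 (.var 10) (.var 11))
    (.seq (.writeN 3 (.var 11) (.add (.var 6) (.lit 1))) (.setN 10 (.add (.var 10) (.lit 1))))

/-- Collect, for all samples, facilities nearest to them. -/
def collect : Prog :=
  .seq (.setN 18 (.add (.var 3) (.lit 1))) (forLt 6 18 (forLt 9 1 (.seq findNearest record)))

/-- Write the next tuple, made of the current candidate and an initial segment of an earlier
tuple. -/
def writeTuple : Prog :=
  .seq (.seq (.writeN 0 (.var 14) (.arr 2 (.var 15))) (.setN 14 (.add (.var 14) (.lit 1))))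
    (.seq
      (forLt 17 13 (.seq (.writeN 0 (.var 14) (.arr 0 (.var 16)))
        (.seq (.setN 14 (.add (.var 14) (.lit 1))) (.setN 16 (.add (.var 16) (.lit 1))))))
      (.seq (.setN 15 (.add (.var 15) (.lit 1)))
        (.seq
          (.ite (.natLt (.var 15) (.var 10)) (.setN 16 (.sub (.var 16) (.var 13)))
            (.seq (.setN 15 (.lit 0)) (.setN 16 (.add (.var 16) (.lit 1)))))
          (.setN 2 (.add (.var 2) (.lit 1))))))

/-- Compute the length of the output list. -/
def computeLength : Prog :=
  .seq (.seq (.setN 13 (.sub (.var 1) (.lit 1))) (.setR 3 (.ofNat (.lit 1))))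
    (forLt 9 1 (.setR 3 (.mul (.var 3) (.ofNat (.var 10)))))

/-- Write all tuples of candidates. -/
def writeTuples : Prog := .seq computeLength (.while (.realLt (.ofNat (.var 2)) (.var 3)) writeTuple)

/-- The sampling rounds. -/
def sampling : Prog := .while (.natLt (.var 6) (.var 3)) round

/-- The whole program. -/
def program : Prog := .seq setup (.seq sampling (.seq collect writeTuples))

/-! ## Correctness of the deterministic parts -/

/-- The number of sampling rounds. -/
noncomputable def numRounds (k : ℕ) (ε : ℝ) : ℕ := ⌈4608 * (k : ℝ) ^ 2 / ε ^ 2⌉₊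

theorem ex_countRounds (O : Oracle) {k : ℕ} {ε : ℝ} (hε : 0 < ε) {σ : State} (h3 : σ.nvar 3 = 0)
    (h1 : σ.nvar 1 = k) (h0 : σ.rvar 0 = ε) :
    Ex O countRounds σ (numRounds k ε * 2 + 1) (fun σ' => σ'.nvar 3 = numRounds k ε) := by
  -- The machine has no rounding operation, so the ceiling is found by counting up; clearing the
  -- denominator gives the loop test.
  have key : ∀ i : ℕ, i < numRounds k ε ↔ (i : ℝ) * (ε * ε) < 4608 * (k * k) := by
    intro i
    rw [numRounds, Nat.lt_ceil, lt_div_iff₀ (by positivity), sq, sq]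
  refine Ex.while_loop (t := 1) (numRounds k ε) (fun i σ => σ.nvar 3 = i) h3 ?_ ?_
  · intro i hi σ' hf h
    have h1' : σ'.nvar 1 = k := by rw [hf.n 1 rfl, h1]
    have h0' : σ'.rvar 0 = ε := by rw [hf.r 0 rfl, h0]
    refine ⟨?_, Ex.straight _ rfl _ (by simp [Prog.exec, State.setN, NExp.eval, h]) le_rfl⟩
    simpa [BExp.Holds, RExp.eval, NExp.eval, h, h1', h0'] using (key i).1 hi
  · intro σ' hf h
    have h1' : σ'.nvar 1 = k := by rw [hf.n 1 rfl, h1]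
    have h0' : σ'.rvar 0 = ε := by rw [hf.r 0 rfl, h0]
    have := (key (numRounds k ε)).not.1 (lt_irrefl _)
    simpa [BExp.Holds, RExp.eval, NExp.eval, h, h1', h0'] using this

/-- Integers cannot be multiplied, so the product is accumulated by repeated addition. -/
theorem ex_computeBound (O : Oracle) {n N : ℕ} {σ : State} (h0 : σ.nvar 0 = n)
    (h3 : σ.nvar 3 = N) (h4 : σ.nvar 4 = 0) :
    Ex O computeBound σ (n * 4 + 3) (fun σ' => σ'.nvar 4 = n * N) := by
  refine Ex.forLt (t := 1) rfl rfl (by decide) n h0 (fun i σ => σ.nvar 4 = i * N)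
    (by simpa [State.setN] using h4) ?_
  intro i hi σ' hf hx h
  have h3' : σ'.nvar 3 = N := by rw [hf.n 3 rfl, h3]
  refine Ex.straight _ rfl _ ?_ le_rfl
  simp [Prog.exec, State.setN, NExp.eval, h, h3', add_mul]

open Classical in
theorem ex_initDist (O : Oracle) {n : ℕ} {σ : State} (h0 : σ.nvar 0 = n)
    (hD : σ.rarr 0 = fun _ => 0) :
    Ex O initDist σ (n * 6 + 3)
      (fun σ' => ∀ x < n, σ'.rarr 0 x = if O.isClient x then O.dist x 0 else 0) := by
  refine (Ex.forLt (t := 3) rfl rfl (by decide) n h0 (fun i σ => ∀ x, σ.rarr 0 x =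
      if x < i ∧ O.isClient x then O.dist x 0 else 0)
    (by simp [State.setN, hD]) ?_).mono le_rfl ?_
  · intro i hi σ' hf hx h
    refine Ex.straight _ rfl _ ?_ le_rfl
    intro x
    by_cases hc : O.isClient i
    · by_cases hxi : x = i
      · subst hxi
        simp [Prog.exec, State.setN, State.writeR, NExp.eval, RExp.eval, BExp.Holds, hx, hc]
      · have : x < i + 1 ↔ x < i := by omega
        simp [Prog.exec, State.setN, State.writeR, NExp.eval, RExp.eval, BExp.Holds, hx, hc, hxi, h,
          this]
    · have : (x < i + 1 ∧ O.isClient x) ↔ (x < i ∧ O.isClient x) := by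
        constructor
        · rintro ⟨h1, h2⟩
          exact ⟨lt_of_le_of_ne (by omega) (fun h => hc (h ▸ h2)), h2⟩
        · rintro ⟨h1, h2⟩
          exact ⟨by omega, h2⟩
      simp only [this]
      simp [Prog.exec, State.setN, skip, NExp.eval, BExp.Holds, hx, hc, h]
  · intro σ' _ h x hx
    simp [h, hx]

/-- The memory before the first round. -/
structure Ready (O : Oracle) (n k N : ℕ) (σ : State) : Prop where
  points : σ.nvar 0 = n
  clusters : σ.nvar 1 = k
  len : σ.nvar 2 = 0
  rounds : σ.nvar 3 = N
  bound : σ.nvar 4 = n * N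
  round : σ.nvar 6 = 0
  latest : σ.nvar 7 = 0
  cand : σ.nvar 10 = 0
  wpos : σ.nvar 14 = 0
  cur : σ.nvar 15 = 0
  rpos : σ.nvar 16 = 0
  samples : σ.narr 1 = fun _ => 0
  marks : σ.narr 3 = fun _ => 0
  dist_client : ∀ x < n, O.isClient x → σ.rarr 0 x = O.dist x 0
  dist_other : ∀ x < n, ¬ O.isClient x → σ.rarr 0 x = 0

theorem ex_setup (O : Oracle) {n k : ℕ} {ε : ℝ} (hε : 0 < ε) :
    Ex O setup (initState n k ε) (numRounds k ε * 2 + n * 10 + 9)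
      (Ready O n k (numRounds k ε)) := by
  classical
  refine ((ex_countRounds O hε (k := k) (σ := initState n k ε) (by simp [initState])
    (by simp [initState]) (by simp [initState])).seq (t := n * 10 + 7) ?_).mono (by omega)
    (fun _ _ h => h)
  intro σ₁ f₁ h₁
  refine ((ex_computeBound O (σ := σ₁) (n := n) (N := numRounds k ε)
    (by rw [f₁.n 0 rfl]; simp [initState]) h₁ (by rw [f₁.n 4 rfl]; simp [initState])).seq
      (t := n * 6 + 3) ?_).mono (by omega) (fun _ _ h => h)
  intro σ₂ f₂ h₂
  refine (ex_initDist O (σ := σ₂) (n := n)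
    (by rw [f₂.n 0 rfl, f₁.n 0 rfl]; simp [initState])
    (by rw [f₂.ra 0 rfl, f₁.ra 0 rfl]; simp [initState])).mono le_rfl ?_
  intro σ₃ f₃ h₃
  have hn : ∀ x, countRounds.wN x = false → computeBound.wN x = false → initDist.wN x = false →
      σ₃.nvar x = (initState n k ε).nvar x := fun x a b c => by
    rw [f₃.n x c, f₂.n x b, f₁.n x a]
  constructor
  case rounds => rw [f₃.n 3 rfl, f₂.n 3 rfl, h₁]
  case bound => rw [f₃.n 4 rfl, h₂]
  case samples => rw [f₃.na 1 rfl, f₂.na 1 rfl, f₁.na 1 rfl]; rfl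
  case marks => rw [f₃.na 3 rfl, f₂.na 3 rfl, f₁.na 3 rfl]; rfl
  case dist_client => intro x hx hc; rw [h₃ x hx, if_pos hc]
  case dist_other => intro x hx hc; rw [h₃ x hx, if_neg hc]
  all_goals rw [hn _ rfl rfl rfl]; rfl

/-! ### One round of distance sampling -/

theorem ex_updateDist (O : Oracle) {n y : ℕ} {σ : State} (h0 : σ.nvar 0 = n)
    (h7 : σ.nvar 7 = y) :
    Ex O updateDist σ (n * 8 + 5) (fun σ' =>
      (∀ x < n, σ'.rarr 0 x = min (σ.rarr 0 x) (O.dist x y)) ∧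
      σ'.rvar 1 = ∑ x ∈ Finset.range n, σ'.rarr 0 x) := by
  have hs : Ex O (.setR 1 (.ofNat (.lit 0))) σ 1 (fun σ' => σ'.rvar 1 = 0) :=
    Ex.straight _ rfl _ (by simp [Prog.exec, State.setR, RExp.eval, NExp.eval]) le_rfl
  refine (hs.seq (t := n * 8 + 3) ?_).mono (by omega) (fun _ _ h => h)
  intro σ₁ f₁ h₁
  refine (Ex.forLt (t := 5) rfl rfl (by decide) n (by rw [f₁.n 0 rfl, h0])
    (fun i σ' => (∀ x, σ'.rarr 0 x =
        if x < i then min (σ.rarr 0 x) (O.dist x y) else σ.rarr 0 x) ∧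
      σ'.rvar 1 = ∑ x ∈ Finset.range i, σ'.rarr 0 x) ?_ ?_).mono le_rfl ?_
  · simp [State.setN, h₁, f₁.ra 0 rfl]
  · rintro i hi σ₂ f₂ hx ⟨h2, h3⟩
    have h7' : σ₂.nvar 7 = y := by rw [f₂.n 7 rfl, f₁.n 7 rfl, h7]
    have hDi : σ₂.rarr 0 i = σ.rarr 0 i := by rw [h2, if_neg (lt_irrefl _)]
    refine Ex.straight _ rfl _ ?_ le_rfl
    have e : ∀ x, (Prog.exec O (.seq (.ite (.realLt (.dist (.var 5) (.var 7)) (.arr 0 (.var 5)))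
        (.writeR 0 (.var 5) (.dist (.var 5) (.var 7))) skip)
          (.setR 1 (.add (.var 1) (.arr 0 (.var 5))))) σ₂).rarr 0 x =
        if x < i + 1 then min (σ.rarr 0 x) (O.dist x y) else σ.rarr 0 x := by
      intro x
      by_cases hc : O.dist i y < σ.rarr 0 i
      · by_cases hxi : x = i
        · subst hxi
          simp [Prog.exec, State.setR, State.writeR, NExp.eval, RExp.eval, BExp.Holds, hx, h7',
            hDi, hc, min_eq_right hc.le]
        · have : x < i + 1 ↔ x < i := by omega
          simp [Prog.exec, State.setR, State.writeR, NExp.eval, RExp.eval, BExp.Holds, hx, h7',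
            hDi, hc, hxi, h2, this]
      · by_cases hxi : x = i
        · subst hxi
          simp [Prog.exec, State.setR, State.setN, skip, NExp.eval, RExp.eval, BExp.Holds, hx, h7',
            hDi, hc, min_eq_left (not_lt.1 hc)]
        · have : x < i + 1 ↔ x < i := by omega
          simp [Prog.exec, State.setR, State.setN, skip, NExp.eval, RExp.eval, BExp.Holds, hx, h7',
            hDi, hc, h2, this]
    refine ⟨e, ?_⟩
    have e' : ∑ x ∈ Finset.range i, (if x < i + 1 then min (σ.rarr 0 x) (O.dist x y)
        else σ.rarr 0 x) = σ₂.rvar 1 := by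
      rw [h3]
      refine Finset.sum_congr rfl fun x hx => ?_
      have := Finset.mem_range.1 hx
      rw [h2, if_pos (by omega), if_pos this]
    simp only [State.setN]
    simp only [e, Finset.sum_range_succ, e']
    by_cases hc : O.dist i y < σ.rarr 0 i
    · simp [Prog.exec, State.setR, State.writeR, NExp.eval, RExp.eval, BExp.Holds, hx, h7',
            hDi, hc, min_eq_right hc.le]
    · simp [Prog.exec, State.setR, State.setN, skip, NExp.eval, RExp.eval, BExp.Holds, hx, h7',
            hDi, hc, min_eq_left (not_lt.1 hc)]
  · rintro σ' - ⟨h2, h3⟩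
    exact ⟨fun x hx => by rw [h2, if_pos hx], h3⟩

/-- `y` is the point selected by the random number `R ≤ m`, for the weights `D` of the points
`0, …, n - 1`. -/
def Selects (n m : ℕ) (D : ℕ → ℝ) (R y : ℕ) : Prop :=
  y < n ∧ ∀ x < n,
    (m + 1 : ℕ) * ∑ z ∈ Finset.range x, D z ≤ R * ∑ z ∈ Finset.range n, D z →
    R * ∑ z ∈ Finset.range n, D z < (m + 1 : ℕ) * ∑ z ∈ Finset.range (x + 1), D z → y = x

/-- The scan overwrites variable 7 as long as the scaled partial sum is at most the scaled random
number. Partial sums of nonnegative weights are monotone, so the last overwrite is at the selected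
point. The default 0 serves only to keep the result below `n`. -/
theorem ex_selectSample (O : Oracle) {n m R i : ℕ} {σ : State} (hn : 0 < n) (h0 : σ.nvar 0 = n)
    (h4 : σ.nvar 4 = m) (h8 : σ.nvar 8 = R) (h6 : σ.nvar 6 = i) (hD : ∀ x < n, 0 ≤ σ.rarr 0 x)
    (hW : σ.rvar 1 = ∑ x ∈ Finset.range n, σ.rarr 0 x) :
    Ex O selectSample σ (n * 8 + 11) (fun σ' => Selects n m (σ.rarr 0) R (σ'.nvar 7) ∧
      σ'.nvar 6 = i + 1 ∧ σ'.narr 1 = Function.update (σ.narr 1) (i + 1) (σ'.nvar 7)) := by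
  have hs : Ex O (.seq (.setN 7 (.lit 0)) (.setR 2 (.ofNat (.lit 0)))) σ 3
      (fun σ' => σ'.nvar 7 = 0 ∧ σ'.rvar 2 = 0) :=
    Ex.straight _ rfl _ (by simp [Prog.exec, State.setN, State.setR, RExp.eval, NExp.eval]) le_rfl
  refine (hs.seq (t := n * 8 + 7) ?_).mono (by omega) (fun _ _ h => h)
  rintro σ₁ f₁ ⟨h₁, h₁'⟩
  have hscan : Ex O scanSums σ₁ (n * 8 + 3) (fun σ' => Selects n m (σ.rarr 0) R (σ'.nvar 7)) := by
    refine (Ex.forLt (t := 5) rfl rfl (by decide) n (by rw [f₁.n 0 rfl, h0])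
      (fun i σ' => σ'.rvar 2 = ∑ x ∈ Finset.range i, σ.rarr 0 x ∧ σ'.nvar 7 < n ∧
        ∀ x < i, (m + 1 : ℕ) * ∑ z ∈ Finset.range x, σ.rarr 0 z ≤
          R * ∑ z ∈ Finset.range n, σ.rarr 0 z →
        R * ∑ z ∈ Finset.range n, σ.rarr 0 z < (m + 1 : ℕ) * ∑ z ∈ Finset.range (x + 1), σ.rarr 0 z →
          σ'.nvar 7 = x) ?_ ?_).mono le_rfl (fun _ _ h => h.2)
    · simp [State.setN, h₁, h₁', hn]
    · rintro i hi σ₂ f₂ hx ⟨h2, h3, h5⟩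
      have e4 : σ₂.nvar 4 = m := by rw [f₂.n 4 rfl, f₁.n 4 rfl, h4]
      have e8 : σ₂.nvar 8 = R := by rw [f₂.n 8 rfl, f₁.n 8 rfl, h8]
      have eW : σ₂.rvar 1 = ∑ x ∈ Finset.range n, σ.rarr 0 x := by
        rw [f₂.r 1 rfl, f₁.r 1 rfl, hW]
      have eD : σ₂.rarr 0 = σ.rarr 0 := by rw [f₂.ra 0 rfl, f₁.ra 0 rfl]
      refine Ex.straight _ rfl _ ?_ le_rfl
      by_cases hc : (R : ℝ) * ∑ x ∈ Finset.range n, σ.rarr 0 x <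
          ((m + 1 : ℕ) : ℝ) * ∑ x ∈ Finset.range i, σ.rarr 0 x
      · have hc' := hc
        push_cast at hc'
        refine ⟨?_, ?_, ?_⟩
        · simp [Prog.exec, State.setR, State.setN, skip, NExp.eval, RExp.eval, BExp.Holds, hx, h2,
            e4, e8, eW, eD, hc', Finset.sum_range_succ]
        · simpa [Prog.exec, State.setR, State.setN, skip, NExp.eval, RExp.eval, BExp.Holds, hx, h2,
            e4, e8, eW, eD, hc'] using h3
        · intro x hxi hle hlt
          rcases Nat.lt_succ_iff_lt_or_eq.1 hxi with hxi | rfl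
          · simpa [Prog.exec, State.setR, State.setN, skip, NExp.eval, RExp.eval, BExp.Holds, hx,
              h2, e4, e8, eW, eD, hc'] using h5 x hxi hle hlt
          · exact absurd hc (not_lt.2 hle)
      · have hc' := hc
        push_cast at hc'
        refine ⟨?_, ?_, ?_⟩
        · simp [Prog.exec, State.setR, State.setN, NExp.eval, RExp.eval, BExp.Holds, hx, h2,
            e4, e8, eW, eD, hc', Finset.sum_range_succ]
        · simpa [Prog.exec, State.setR, State.setN, NExp.eval, RExp.eval, BExp.Holds, hx, h2,
            e4, e8, eW, eD, hc'] using hi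
        · intro x hxi hle hlt
          rcases Nat.lt_succ_iff_lt_or_eq.1 hxi with hxi | rfl
          -- An earlier selected point would already have pushed the partial sum past the threshold,
          -- so the overwrite at the current point could not happen.
          · refine absurd (hlt.trans_le (mul_le_mul_of_nonneg_left ?_ (Nat.cast_nonneg _))) hc
            refine Finset.sum_le_sum_of_subset_of_nonneg ?_ ?_
            · intro z; simp only [Finset.mem_range]; omega
            · intro z hz _
              exact hD z (by have := Finset.mem_range.1 hz; omega)
          · simp [Prog.exec, State.setR, State.setN, NExp.eval, RExp.eval, BExp.Holds, hx,
              h2, e4, e8, eW, eD, hc']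
  refine (hscan.seq (t := 3) ?_).mono (by omega) (fun _ _ h => h)
  intro σ₂ f₂ h₂
  have e6 : σ₂.nvar 6 = i := by rw [f₂.n 6 rfl, f₁.n 6 rfl, h6]
  have eS : σ₂.narr 1 = σ.narr 1 := by rw [f₂.na 1 rfl, f₁.na 1 rfl]
  refine Ex.straight _ rfl _ ?_ le_rfl
  simpa [Prog.exec, State.setN, State.writeN, NExp.eval, e6, eS] using h₂

/-! ### Facilities nearest to a sample point -/

theorem ex_findNearest (O : Oracle) {n i : ℕ} {σ : State} (hF : ∀ x, O.isFacility x → x < n)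
    (h0 : σ.nvar 0 = n) (h6 : σ.nvar 6 = i) :
    Ex O findNearest σ (n * 8 + 5) (fun σ' =>
      (O.isFacility (σ'.nvar 11) ∧ σ.narr 3 (σ'.nvar 11) < i + 1 ∧
        ∀ f, O.isFacility f → σ.narr 3 f < i + 1 →
          O.dist (σ'.nvar 11) (σ.narr 1 i) ≤ O.dist f (σ.narr 1 i)) ∨
      (σ'.nvar 11 = σ.nvar 11 ∧ ∀ f, O.isFacility f → ¬ σ.narr 3 f < i + 1)) := by
  have hs : Ex O (.setN 12 (.lit 0)) σ 1 (fun σ' => σ'.nvar 12 = 0) :=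
    Ex.straight _ rfl _ (by simp [Prog.exec, State.setN, NExp.eval]) le_rfl
  refine (hs.seq (t := n * 8 + 3) ?_).mono (by omega) (fun _ _ h => h)
  intro σ₁ f₁ h₁
  refine (Ex.forLt (t := 5) rfl rfl (by decide) n (by rw [f₁.n 0 rfl, h0])
    (fun j σ' =>
      (0 < σ'.nvar 12 ∧ O.isFacility (σ'.nvar 11) ∧ σ.narr 3 (σ'.nvar 11) < i + 1 ∧
        ∀ f < j, O.isFacility f → σ.narr 3 f < i + 1 →
          O.dist (σ'.nvar 11) (σ.narr 1 i) ≤ O.dist f (σ.narr 1 i)) ∨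
      (σ'.nvar 12 = 0 ∧ σ'.nvar 11 = σ.nvar 11 ∧
        ∀ f < j, O.isFacility f → ¬ σ.narr 3 f < i + 1)) ?_ ?_).mono le_rfl ?_
  · right
    simp [State.setN, h₁, f₁.n 11 rfl]
  · intro j hj σ₂ f₂ hx h
    have e6 : σ₂.nvar 6 = i := by rw [f₂.n 6 rfl, f₁.n 6 rfl, h6]
    have e1 : σ₂.narr 1 = σ.narr 1 := by rw [f₂.na 1 rfl, f₁.na 1 rfl]
    have e3 : σ₂.narr 3 = σ.narr 3 := by rw [f₂.na 3 rfl, f₁.na 3 rfl]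
    refine Ex.straight _ rfl _ ?_ le_rfl
    -- Point `j` replaces the current choice if nothing has been found yet or `j` is strictly
    -- closer; the tests have no disjunction, hence the negated conjunction.
    by_cases hc : O.isFacility j ∧ σ.narr 3 j < i + 1 ∧ ¬ (0 < σ₂.nvar 12 ∧
        ¬ O.dist j (σ.narr 1 i) < O.dist (σ₂.nvar 11) (σ.narr 1 i))
    · rw [Prog.exec, if_pos (by simpa [BExp.Holds, NExp.eval, RExp.eval, hx, e6, e1, e3] using hc)]
      left
      obtain ⟨hc1, hc2, hc3⟩ := hc
      have hmin : ∀ f < j + 1, O.isFacility f → σ.narr 3 f < i + 1 →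
          O.dist j (σ.narr 1 i) ≤ O.dist f (σ.narr 1 i) := by
        intro f hf hff hfm
        rcases Nat.lt_succ_iff_lt_or_eq.1 hf with hf | rfl
        · rcases h with ⟨hp, -, -, h⟩ | ⟨-, -, h⟩
          · push Not at hc3
            exact (hc3 hp).le.trans (h f hf hff hfm)
          · exact absurd hfm (h f hf hff)
        · exact le_rfl
      simpa [Prog.exec, State.setN, NExp.eval, hx, hc1, Nat.lt_succ_iff.1 hc2] using
        fun f hf hff hfm => hmin f (by omega) hff (by omega)
    · rw [Prog.exec, if_neg (by simpa [BExp.Holds, NExp.eval, RExp.eval, hx, e6, e1, e3] using hc)]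
      have e11 : ((skip.exec O σ₂).setN 5 (j + 1)).nvar 11 = σ₂.nvar 11 := by
        simp [skip, Prog.exec, State.setN]
      have e12 : ((skip.exec O σ₂).setN 5 (j + 1)).nvar 12 = σ₂.nvar 12 := by
        simp [skip, Prog.exec, State.setN]
      rw [e11, e12]
      rcases h with ⟨hp, ha, hb, h⟩ | ⟨hp, ha, h⟩
      · refine Or.inl ⟨hp, ha, hb, fun f hf hff hfm => ?_⟩
        rcases Nat.lt_succ_iff_lt_or_eq.1 hf with hf | rfl
        · exact h f hf hff hfm
        · by_contra hlt
          exact hc ⟨hff, hfm, fun h' => h'.2 (not_le.1 hlt)⟩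
      · refine Or.inr ⟨hp, ha, fun f hf hff hfm => ?_⟩
        rcases Nat.lt_succ_iff_lt_or_eq.1 hf with hf | rfl
        · exact h f hf hff hfm
        · exact hc ⟨hff, hfm, fun h' => by omega⟩
  · rintro σ' - (⟨-, ha, hb, h⟩ | ⟨-, ha, h⟩)
    · exact Or.inl ⟨ha, hb, fun f hf => h f (hF f hf) hf⟩
    · exact Or.inr ⟨ha, fun f hf => h f (hF f hf) hf⟩

/-- The entries `off, …, off + k - 1` of `A` are facilities; they are pairwise distinct and nearest
to the point `s`, unless they include all facilities. -/
def Near (O : Oracle) (k : ℕ) (A : ℕ → ℕ) (off s : ℕ) : Prop :=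
  (∀ r < k, O.isFacility (A (off + r))) ∧
  ∀ f, O.isFacility f → (∃ r < k, A (off + r) = f) ∨
    ((∀ a < k, ∀ b < k, A (off + a) = A (off + b) → a = b) ∧
      ∀ a < k, O.dist (A (off + a)) s ≤ O.dist f s)

/-- Invariant of the collection of the facilities nearest to `s`: `r` of them are found and marked
in `mk` by a value that is not smaller than `c`. -/
structure NearInv (O : Oracle) (c s off : ℕ) (A mk : ℕ → ℕ) (r : ℕ) : Prop where
  fac : ∀ a < r, O.isFacility (A (off + a)) ∧ ¬ mk (A (off + a)) < c
  cov : ∀ f, O.isFacility f → ¬ mk f < c → ∃ a < r, A (off + a) = f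
  unm : ∀ f, O.isFacility f → mk f < c →
    (∀ a < r, ∀ b < r, A (off + a) = A (off + b) → a = b) ∧
      ∀ a < r, O.dist (A (off + a)) s ≤ O.dist f s

theorem NearInv.near {O : Oracle} {c s off : ℕ} {A mk : ℕ → ℕ} {k : ℕ}
    (h : NearInv O c s off A mk k) : Near O k A off s := by
  refine ⟨fun r hr => (h.fac r hr).1, fun f hf => ?_⟩
  by_cases hm : mk f < c
  · exact Or.inr (h.unm f hf hm)
  · exact Or.inl (h.cov f hf hm)

/-- An unmarked nearest `b` differs from all earlier entries, which are marked, and is at most as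
far as every facility still unmarked. Once all facilities are marked, `unm` is vacuous and repeating
an entry does no harm. -/
theorem NearInv.succ {O : Oracle} {c s off : ℕ} {A mk : ℕ → ℕ} {r b : ℕ}
    (h : NearInv O c s off A mk r)
    (hb : (O.isFacility b ∧ mk b < c ∧
        ∀ f, O.isFacility f → mk f < c → O.dist b s ≤ O.dist f s) ∨
      (O.isFacility b ∧ ∀ f, O.isFacility f → ¬ mk f < c)) :
    NearInv O c s off (Function.update A (off + r) b) (Function.update mk b c) (r + 1) := by
  have hA : ∀ a < r, Function.update A (off + r) b (off + a) = A (off + a) := fun a ha =>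
    Function.update_of_ne (by omega) _ _
  have hAr : Function.update A (off + r) b (off + r) = b := Function.update_self _ _ _
  have hmk : ∀ x, ¬ mk x < c → ¬ Function.update mk b c x < c := by
    intro x hx
    rw [Function.update_apply]
    split_ifs <;> omega
  have hmk' : ∀ x, Function.update mk b c x < c → x ≠ b ∧ mk x < c := by
    intro x hx
    rw [Function.update_apply] at hx
    split_ifs at hx with hxb
    · omega
    · exact ⟨hxb, hx⟩
  have hbf : O.isFacility b := by rcases hb with hb | hb <;> exact hb.1
  refine ⟨?_, ?_, ?_⟩
  · intro a ha
    rcases Nat.lt_succ_iff_lt_or_eq.1 ha with ha | rfl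
    · rw [hA a ha]
      exact ⟨(h.fac a ha).1, hmk _ (h.fac a ha).2⟩
    · rw [hAr]
      exact ⟨hbf, by simp⟩
  · intro f hf hm
    by_cases hfb : f = b
    · exact ⟨r, by omega, by rw [hAr, hfb]⟩
    · rw [Function.update_of_ne hfb] at hm
      obtain ⟨a, ha, e⟩ := h.cov f hf hm
      exact ⟨a, by omega, by rw [hA a ha, e]⟩
  · intro f hf hm
    obtain ⟨hfb, hm⟩ := hmk' f hm
    rcases hb with ⟨-, hbm, hmin⟩ | ⟨-, hall⟩
    · obtain ⟨h1, h2⟩ := h.unm f hf hm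
      refine ⟨?_, ?_⟩
      · intro a ha a' ha' e
        rcases Nat.lt_succ_iff_lt_or_eq.1 ha with ha | rfl <;>
          rcases Nat.lt_succ_iff_lt_or_eq.1 ha' with ha' | rfl
        · rw [hA a ha, hA a' ha'] at e
          exact h1 a ha a' ha' e
        · rw [hA a ha, hAr] at e
          exact absurd (e ▸ hbm) (h.fac a ha).2
        · rw [hA a' ha', hAr] at e
          exact absurd (e ▸ hbm) (h.fac a' ha').2
        · rfl
      · intro a ha
        rcases Nat.lt_succ_iff_lt_or_eq.1 ha with ha | rfl
        · rw [hA a ha]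
          exact h2 a ha
        · rw [hAr]
          exact hmin f hf hm
    · exact absurd hm (hall f hf)

theorem ex_record (O : Oracle) {i w b : ℕ} {σ : State} (h6 : σ.nvar 6 = i) (h10 : σ.nvar 10 = w)
    (h11 : σ.nvar 11 = b) :
    Ex O record σ 5 (fun σ' => σ'.narr 2 = Function.update (σ.narr 2) w b ∧
      σ'.narr 3 = Function.update (σ.narr 3) b (i + 1) ∧ σ'.nvar 10 = w + 1) := by
  refine Ex.straight _ rfl _ ?_ le_rfl
  simp [record, Prog.exec, State.setN, State.writeN, NExp.eval, h6, h10, h11]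

theorem Near.congr {O : Oracle} {k : ℕ} {A B : ℕ → ℕ} {off s : ℕ} (h : Near O k A off s)
    (hAB : ∀ r < k, B (off + r) = A (off + r)) : Near O k B off s := by
  refine ⟨fun r hr => hAB r hr ▸ h.1 r hr, fun f hf => ?_⟩
  rcases h.2 f hf with ⟨r, hr, e⟩ | ⟨h1, h2⟩
  · exact Or.inl ⟨r, hr, by rw [hAB r hr, e]⟩
  · refine Or.inr ⟨fun a ha b hb e => h1 a ha b hb ?_, fun a ha => ?_⟩
    · rwa [hAB a ha, hAB b hb] at e
    · rw [hAB a ha]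
      exact h2 a ha

theorem ex_collect (O : Oracle) {n k N : ℕ} {σ : State} (hF : ∀ x, O.isFacility x → x < n)
    (hne : ∃ f, O.isFacility f) (h0 : σ.nvar 0 = n) (h1 : σ.nvar 1 = k) (h3 : σ.nvar 3 = N)
    (h10 : σ.nvar 10 = 0) (hmk : σ.narr 3 = fun _ => 0) :
    Ex O collect σ ((N + 1) * (k * (n * 8 + 14) + 6) + 5) (fun σ' => σ'.nvar 10 = (N + 1) * k ∧
      ∀ i < N + 1, Near O k (σ'.narr 2) (i * k) (σ.narr 1 i)) := by
  have hs : Ex O (.setN 18 (.add (.var 3) (.lit 1))) σ 1 (fun σ' => σ'.nvar 18 = N + 1) :=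
    Ex.straight _ rfl _ (by simp [Prog.exec, State.setN, NExp.eval, h3]) le_rfl
  refine (hs.seq (t := (N + 1) * (k * (n * 8 + 14) + 6) + 3) ?_).mono (by omega) (fun _ _ h => h)
  intro σ₁ f₁ h₁
  refine (Ex.forLt (t := k * (n * 8 + 14) + 3) rfl rfl (by decide) (N + 1) h₁
    (fun i σ' => σ'.nvar 10 = i * k ∧ (∀ x, σ'.narr 3 x ≤ i) ∧
      ∀ j < i, Near O k (σ'.narr 2) (j * k) (σ.narr 1 j)) ?_ ?_).mono le_rfl
        (fun _ _ h => ⟨h.1, h.2.2⟩)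
  · simp [State.setN, f₁.n 10 rfl, h10, f₁.na 3 rfl, hmk]
  rintro i hi σ₂ f₂ hx ⟨e10, e3, hnear⟩
  -- Marks left by earlier samples are at most `i`, below the threshold `i + 1`, so the array of
  -- marks never has to be cleared. The last clause of the invariant keeps a facility in variable 11
  -- for repetition when fewer than `k` exist.
  refine (Ex.forLt (t := n * 8 + 11) rfl rfl (by decide) k
    (by rw [f₂.n 1 rfl, f₁.n 1 rfl, h1])
    (fun r σ' => σ'.nvar 10 = i * k + r ∧ (∀ x, σ'.narr 3 x ≤ i + 1) ∧
      (∀ q < i * k, σ'.narr 2 q = σ₂.narr 2 q) ∧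
      NearInv O (i + 1) (σ.narr 1 i) (i * k) (σ'.narr 2) (σ'.narr 3) r ∧
      (0 < r → O.isFacility (σ'.nvar 11) ∧ ¬ σ'.narr 3 (σ'.nvar 11) < i + 1)) ?_ ?_).mono le_rfl ?_
  · refine ⟨by simp [State.setN, e10], fun x => (e3 x).trans (by omega), fun q _ => rfl,
      ⟨fun a ha => by omega, fun f _ hf => ?_, fun f _ hf => ⟨?_, ?_⟩⟩, fun h => by omega⟩
    · have := e3 f
      simp only [State.setN] at hf
      omega
    · intro a ha; omega
    · intro a ha; omega
  · rintro r hr σ₃ f₃ - ⟨g10, g3, gq, gN, g11⟩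
    have e6 : σ₃.nvar 6 = i := by rw [f₃.n 6 rfl, hx]
    have e1 : σ₃.narr 1 = σ.narr 1 := by rw [f₃.na 1 rfl, f₂.na 1 rfl, f₁.na 1 rfl]
    have e0 : σ₃.nvar 0 = n := by rw [f₃.n 0 rfl, f₂.n 0 rfl, f₁.n 0 rfl, h0]
    refine ((ex_findNearest O hF e0 e6).seq (t := 5) ?_).mono (by omega) (fun _ _ h => h)
    intro σ₄ f₄ h₄
    refine (ex_record O (σ := σ₄) (by rw [f₄.n 6 rfl, e6]) (by rw [f₄.n 10 rfl, g10]) rfl).mono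
      le_rfl ?_
    rintro σ₅ f₅ ⟨k2, k3, k10⟩
    rw [f₄.na 2 rfl] at k2
    rw [f₄.na 3 rfl] at k3
    rw [e1] at h₄
    have hb : (O.isFacility (σ₄.nvar 11) ∧ σ₃.narr 3 (σ₄.nvar 11) < i + 1 ∧
        ∀ f, O.isFacility f → σ₃.narr 3 f < i + 1 →
          O.dist (σ₄.nvar 11) (σ.narr 1 i) ≤ O.dist f (σ.narr 1 i)) ∨
        (O.isFacility (σ₄.nvar 11) ∧ ∀ f, O.isFacility f → ¬ σ₃.narr 3 f < i + 1) := by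
      rcases h₄ with h | ⟨e, h⟩
      · exact Or.inl h
      · refine Or.inr ⟨?_, h⟩
        -- The search found nothing, so the previous facility is recorded again. This cannot occur
        -- at `r = 0`: some facility exists, and none is marked yet.
        rcases Nat.eq_zero_or_pos r with rfl | hr0
        · obtain ⟨f, hf⟩ := hne
          obtain ⟨a, ha, -⟩ := gN.cov f hf (h f hf)
          omega
        · rw [e]
          exact (g11 hr0).1
    refine ⟨?_, ?_, ?_, ?_, ?_⟩
    · simpa [State.setN, add_assoc] using k10
    · intro x
      have := g3 x
      simp only [State.setN, k3, Function.update_apply]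
      split_ifs <;> omega
    · intro q hq
      simp only [State.setN, k2]
      rw [Function.update_of_ne (by omega), gq q hq]
    · simp only [State.setN, k2, k3]
      exact gN.succ hb
    · intro _
      have e11 : σ₅.nvar 11 = σ₄.nvar 11 := f₅.n 11 rfl
      simp only [State.setN, k3]
      rw [Function.update_of_ne (by decide), e11]
      refine ⟨?_, by simp⟩
      rcases hb with hb | hb <;> exact hb.1
  · rintro σ₃ f₃ ⟨g10, g3, gq, gN, -⟩
    refine ⟨by simp [State.setN, g10, add_mul], g3, fun j hj => ?_⟩
    rcases Nat.lt_succ_iff_lt_or_eq.1 hj with hj | rfl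
    · refine (hnear j hj).congr fun r hr => gq _ ?_
      have : (j + 1) * k ≤ i * k := Nat.mul_le_mul_right _ (by omega)
      rw [add_mul] at this
      omega
    · exact gN.near

/-! ### Writing all tuples -/

/-- The entry at position `p` of the concatenation of all `k`-tuples of the first `q` elements
of `A`. -/
def tupleEntry (A : ℕ → ℕ) (k q p : ℕ) : ℕ := A (p / k / q ^ (p % k) % q)

theorem tupleEntry_mul_add (A : ℕ → ℕ) {k : ℕ} (q t : ℕ) {j : ℕ} (hj : j < k) :
    tupleEntry A k q (t * k + j) = A (t / q ^ j % q) := by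
  have h1 : (t * k + j) / k = t := by
    rw [mul_comm, Nat.mul_add_div (by omega), Nat.div_eq_of_lt hj, add_zero]
  have h2 : (t * k + j) % k = j := by
    rw [mul_comm, Nat.mul_add_mod, Nat.mod_eq_of_lt hj]
  rw [tupleEntry, h1, h2]

/-- Tuple `t` lists the base-`q` digits of `t`, lowest first. Its first entry is thus digit `t % q`,
and the other `κ` are the first `κ` entries of tuple `t / q`, so it is copied in time linear in `κ`
without any division. -/
theorem ex_writeTuple (O : Oracle) {κ q t : ℕ} {A : ℕ → ℕ} {σ : State} (hq : 0 < q)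
    (hA : σ.narr 2 = A) (h2 : σ.nvar 2 = t) (h10 : σ.nvar 10 = q) (h13 : σ.nvar 13 = κ)
    (h14 : σ.nvar 14 = t * (κ + 1)) (h15 : σ.nvar 15 = t % q)
    (h16 : σ.nvar 16 = t / q * (κ + 1))
    (hout : ∀ p < t * (κ + 1), σ.narr 0 p = tupleEntry A (κ + 1) q p) :
    Ex O writeTuple σ (κ * 8 + 17) (fun σ' => σ'.nvar 2 = t + 1 ∧
      σ'.nvar 14 = (t + 1) * (κ + 1) ∧ σ'.nvar 15 = (t + 1) % q ∧
      σ'.nvar 16 = (t + 1) / q * (κ + 1) ∧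
      ∀ p < (t + 1) * (κ + 1), σ'.narr 0 p = tupleEntry A (κ + 1) q p) := by
  have hs : Ex O (.seq (.writeN 0 (.var 14) (.arr 2 (.var 15)))
      (.setN 14 (.add (.var 14) (.lit 1)))) σ 3 (fun σ' => σ'.nvar 14 = t * (κ + 1) + 1 ∧
        ∀ p < t * (κ + 1) + 1, σ'.narr 0 p = tupleEntry A (κ + 1) q p) := by
    refine Ex.straight _ rfl _ ⟨by simp [Prog.exec, State.setN, State.writeN, NExp.eval, h14], ?_⟩
      le_rfl
    intro p hp
    rcases Nat.lt_succ_iff_lt_or_eq.1 hp with hp | rfl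
    · simp [Prog.exec, State.setN, State.writeN, NExp.eval, h14, hp.ne, hout p hp]
    · have := tupleEntry_mul_add A (k := κ + 1) q t (j := 0) (by omega)
      simp only [add_zero, pow_zero, Nat.div_one] at this
      simp [Prog.exec, State.setN, State.writeN, NExp.eval, h14, h15, hA, this]
  refine (hs.seq (t := κ * 8 + 13) ?_).mono (by omega) (fun _ _ h => h)
  rintro σ₁ f₁ ⟨a14, aout⟩
  refine ((Ex.forLt (t := 5) rfl rfl (by decide) κ (by rw [f₁.n 13 rfl, h13])
    (fun j σ' => σ'.nvar 14 = t * (κ + 1) + 1 + j ∧ σ'.nvar 16 = t / q * (κ + 1) + j ∧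
      ∀ p < t * (κ + 1) + 1 + j, σ'.narr 0 p = tupleEntry A (κ + 1) q p) ?_ ?_).seq
      (t := 9) ?_).mono (by omega) (fun _ _ h => h)
  · refine ⟨by simp [State.setN, a14], by simp [State.setN, f₁.n 16 rfl, h16], ?_⟩
    simpa [State.setN] using aout
  · rintro j hj σ₂ f₂ - ⟨b14, b16, bout⟩
    have hle : t / q * (κ + 1) ≤ t * (κ + 1) := Nat.mul_le_mul_right _ (Nat.div_le_self _ _)
    -- The entry read is already written even if `t / q = t`, as for `t = 0` or `q = 1`: reading
    -- stays one position behind writing.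
    have hread : σ₂.narr 0 (t / q * (κ + 1) + j) =
        tupleEntry A (κ + 1) q (t * (κ + 1) + (j + 1)) := by
      rw [bout _ (by omega), tupleEntry_mul_add _ _ _ (by omega), tupleEntry_mul_add _ _ _ (by omega),
        Nat.div_div_eq_div_mul, pow_succ']
    refine Ex.straight _ rfl _ ⟨?_, ?_, ?_⟩ le_rfl
    · simp [Prog.exec, State.setN, State.writeN, NExp.eval, b14, add_assoc]
    · simp [Prog.exec, State.setN, State.writeN, NExp.eval, b16, add_assoc]
    · intro p hp
      obtain hp | rfl : p < t * (κ + 1) + 1 + j ∨ p = t * (κ + 1) + 1 + j := by omega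
      · simp [Prog.exec, State.setN, State.writeN, NExp.eval, b14, hp.ne, bout p hp]
      · have e : t * (κ + 1) + 1 + j = t * (κ + 1) + (j + 1) := by ring
        simp [Prog.exec, State.setN, State.writeN, NExp.eval, b14, b16, hread, e]
  · rintro σ₂ f₂ ⟨b14, b16, bout⟩
    have b2 : σ₂.nvar 2 = t := by rw [f₂.n 2 rfl, f₁.n 2 rfl, h2]
    have b10 : σ₂.nvar 10 = q := by rw [f₂.n 10 rfl, f₁.n 10 rfl, h10]
    have b13 : σ₂.nvar 13 = κ := by rw [f₂.n 13 rfl, f₁.n 13 rfl, h13]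
    have b15 : σ₂.nvar 15 = t % q := by rw [f₂.n 15 rfl, f₁.n 15 rfl, h15]
    have ew : t * (κ + 1) + 1 + κ = (t + 1) * (κ + 1) := by ring
    refine Ex.straight _ rfl _ ?_ le_rfl
    have hdm := Nat.div_add_mod t q
    by_cases hc : t % q + 1 < q
    · have hu := (Nat.div_mod_unique (a := t + 1) (d := t / q) (c := t % q + 1) hq).2
        ⟨by omega, hc⟩
      rw [← ew, hu.1, hu.2]
      simpa [Prog.exec, State.setN, NExp.eval, BExp.Holds, b2, b10, b13, b14, b15, b16, hc]
        using bout
    · have hlt := Nat.mod_lt t hq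
      have hu := (Nat.div_mod_unique (a := t + 1) (d := t / q + 1) (c := 0) hq).2
        ⟨by rw [mul_add]; omega, hq⟩
      rw [← ew, hu.1, hu.2]
      simp [Prog.exec, State.setN, NExp.eval, BExp.Holds, b2, b10, b14, b15, b16, hc]
      exact ⟨by ring, bout⟩

/-- The length `q ^ (κ + 1)` is computed as a real number, where multiplication is available, and
the loop compares the integer counter with it. -/
theorem ex_writeTuples (O : Oracle) {κ q : ℕ} {σ : State} (hq : 0 < q) (h1 : σ.nvar 1 = κ + 1)
    (h2 : σ.nvar 2 = 0) (h10 : σ.nvar 10 = q) (h14 : σ.nvar 14 = 0) (h15 : σ.nvar 15 = 0)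
    (h16 : σ.nvar 16 = 0) :
    Ex O writeTuples σ (q ^ (κ + 1) * (κ * 8 + 18) + κ * 4 + 13) (fun σ' =>
      σ'.nvar 2 = q ^ (κ + 1) ∧ ∀ t < q ^ (κ + 1), ∀ j < κ + 1,
        σ'.narr 0 (t * (κ + 1) + j) = σ.narr 2 (t / q ^ j % q)) := by
  have hs : Ex O (.seq (.setN 13 (.sub (.var 1) (.lit 1))) (.setR 3 (.ofNat (.lit 1)))) σ 3
      (fun σ' => σ'.nvar 13 = κ ∧ σ'.rvar 3 = 1) :=
    Ex.straight _ rfl _ (by simp [Prog.exec, State.setN, State.setR, RExp.eval, NExp.eval, h1])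
      le_rfl
  have hl : Ex O computeLength σ (κ * 4 + 11)
      (fun σ' => σ'.nvar 13 = κ ∧ σ'.rvar 3 = (q : ℝ) ^ (κ + 1)) := by
    refine (hs.seq (t := (κ + 1) * 4 + 3) ?_).mono (by omega) (fun _ _ h => h)
    rintro σ₁ f₁ ⟨a13, a3⟩
    refine (Ex.forLt (t := 1) rfl rfl (by decide) (κ + 1) (by rw [f₁.n 1 rfl, h1])
      (fun i σ' => σ'.rvar 3 = (q : ℝ) ^ i) (by simpa [State.setN] using a3) ?_).mono le_rfl
      (fun σ' f' h => ⟨by rw [f'.n 13 rfl, a13], h⟩)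
    intro i hi σ₂ f₂ _ b3
    have b10 : σ₂.nvar 10 = q := by rw [f₂.n 10 rfl, f₁.n 10 rfl, h10]
    exact Ex.straight _ rfl _ (by
      simp [Prog.exec, State.setN, State.setR, RExp.eval, NExp.eval, b10, b3, pow_succ]) le_rfl
  refine (hl.seq (t := q ^ (κ + 1) * (κ * 8 + 18) + 1) ?_).mono (by omega) (fun _ _ h => h)
  rintro σ₁ f₁ ⟨a13, a3⟩
  refine (Ex.while_loop (t := κ * 8 + 17) (q ^ (κ + 1)) (fun t σ' => σ'.nvar 2 = t ∧
      σ'.nvar 14 = t * (κ + 1) ∧ σ'.nvar 15 = t % q ∧ σ'.nvar 16 = t / q * (κ + 1) ∧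
      ∀ p < t * (κ + 1), σ'.narr 0 p = tupleEntry (σ.narr 2) (κ + 1) q p) ?_ ?_ ?_).mono le_rfl ?_
  · simp [f₁.n 2 rfl, h2, f₁.n 14 rfl, h14, f₁.n 15 rfl, h15, f₁.n 16 rfl, h16]
  · rintro t ht σ₂ f₂ ⟨b2, b14, b15, b16, bout⟩
    have b3 : σ₂.rvar 3 = (q : ℝ) ^ (κ + 1) := by rw [f₂.r 3 rfl, a3]
    refine ⟨by simpa [BExp.Holds, RExp.eval, NExp.eval, b2, b3] using by exact_mod_cast ht, ?_⟩
    exact ex_writeTuple O hq (by rw [f₂.na 2 rfl, f₁.na 2 rfl]) b2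
      (by rw [f₂.n 10 rfl, f₁.n 10 rfl, h10]) (by rw [f₂.n 13 rfl, a13]) b14 b15 b16 bout
  · rintro σ₂ f₂ ⟨b2, -⟩
    have b3 : σ₂.rvar 3 = (q : ℝ) ^ (κ + 1) := by rw [f₂.r 3 rfl, a3]
    simp [BExp.Holds, RExp.eval, NExp.eval, b2, b3]
  · rintro σ₂ f₂ ⟨b2, -, -, -, bout⟩
    refine ⟨b2, fun t ht j hj => ?_⟩
    rw [bout, tupleEntry_mul_add _ _ _ hj]
    calc t * (κ + 1) + j < (t + 1) * (κ + 1) := by rw [add_mul t 1]; omega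
      _ ≤ _ := Nat.mul_le_mul_right _ ht

/-! ## Analysis of the sampling -/

section Progress

variable {X : Type*} [MetricSpace X]

/-- The cost of the cluster with index set `A` and centre `c`, the points being numbered
by `pt`. -/
noncomputable def idxCost (pt : ℕ → X) (A : Finset ℕ) (c : X) : ℝ := ∑ x ∈ A, dist (pt x) c

theorem idxCost_nonneg (pt : ℕ → X) (A : Finset ℕ) (c : X) : 0 ≤ idxCost pt A c :=
  Finset.sum_nonneg fun _ _ => dist_nonneg

/-- The point numbered `s` can replace the centre `c` of the cluster `A`, up to an error governed
by `η` and the load `M`. -/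
def Serves (pt : ℕ → X) (η M : ℝ) (A : Finset ℕ) (c : X) (s : ℕ) : Prop :=
  A.card * dist (pt s) c ≤ (1 + η) * idxCost pt A c + η * M

open Classical in
/-- The points of the cluster `A` whose distance to the centre is not much larger than average. -/
noncomputable def core (pt : ℕ → X) (η : ℝ) (A : Finset ℕ) (c : X) : Finset ℕ :=
  A.filter fun x => A.card * dist (pt x) c ≤ (1 + η / 2) * idxCost pt A c

theorem serves_of_mem_core {pt : ℕ → X} {η M : ℝ} (hη : 0 < η) (hM : 0 ≤ M) {A : Finset ℕ} {c : X}
    {x : ℕ} (hx : x ∈ core pt η A c) : Serves pt η M A c x := by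
  classical
  have h := (Finset.mem_filter.1 hx).2
  have h0 := idxCost_nonneg pt A c
  unfold Serves
  nlinarith [mul_nonneg hη.le h0, mul_nonneg hη.le hM]

/-- Markov's inequality: at most a fraction 1/(1+η/2) of the points exceeds (1+η/2) times the
average, and the remaining fraction (η/2)/(1+η/2) is at least η/3. -/
theorem card_le_card_core (pt : ℕ → X) {η : ℝ} (hη : 0 < η) (hη1 : η ≤ 1) (A : Finset ℕ) (c : X) :
    A.card * η ≤ 3 * (core pt η A c).card := by
  classical
  set B := core pt η A c with hB
  set a := A.filter fun x => ¬ A.card * dist (pt x) c ≤ (1 + η / 2) * idxCost pt A c with ha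
  have hcard : (B.card : ℝ) + a.card = A.card := by
    exact_mod_cast Finset.card_filter_add_card_filter_not (s := A) _
  have hA : (a.card : ℝ) * (1 + η / 2) ≤ A.card := by
    -- Markov's inequality divides by the cost; at cost zero every point coincides with the centre
    -- and none lies outside the core.
    rcases (idxCost_nonneg pt A c).eq_or_lt with h0 | h0
    · have : a = ∅ := by
        rw [ha, Finset.filter_eq_empty_iff]
        intro x hx
        have hz := (Finset.sum_eq_zero_iff_of_nonneg (fun _ _ => dist_nonneg)).1 h0.symm x hx
        rw [not_not, hz, ← h0]
        simp
      simp [this]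
    · have h1 : (a.card : ℝ) * ((1 + η / 2) * idxCost pt A c) ≤ A.card * idxCost pt A c := by
        calc (a.card : ℝ) * ((1 + η / 2) * idxCost pt A c)
            ≤ ∑ x ∈ a, A.card * dist (pt x) c := by
              rw [← nsmul_eq_mul]
              refine Finset.card_nsmul_le_sum _ _ _ fun x hx => ?_
              exact (not_le.1 (Finset.mem_filter.1 hx).2).le
          _ ≤ ∑ x ∈ A, A.card * dist (pt x) c :=
              Finset.sum_le_sum_of_subset_of_nonneg (Finset.filter_subset _ _)
                fun _ _ _ => by positivity
          _ = _ := by rw [← Finset.mul_sum]; rfl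
      rw [← mul_assoc] at h1
      exact le_of_mul_le_mul_right h1 h0
  have hb : (0 : ℝ) ≤ B.card := by positivity
  nlinarith

/-- Let Δ be the distance of the centre to the sample. Core points satisfy |A| D(x) ≥ E = |A|Δ -
(1+η/2)z by the triangle inequality, and since the cluster is unserved, E exceeds ηM and is at least
(η/4)|A|Δ. There are at least η|A|/3 core points, so their sum is at least ηE/3, whereas the whole
cluster sums to at most z + |A|Δ ≤ 2|A|Δ ≤ 8E/η. -/
theorem sum_le_core {pt : ℕ → X} {η M : ℝ} (hη : 0 < η) (hη1 : η ≤ 1) {A : Finset ℕ} {c : X}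
    (hM : idxCost pt A c ≤ M) {S : Finset ℕ} (hS : S.Nonempty) {D : ℕ → ℝ}
    (hD1 : ∀ x ∈ A, ∃ s ∈ S, D x = dist (pt x) (pt s))
    (hD2 : ∀ x ∈ A, ∀ s ∈ S, D x ≤ dist (pt x) (pt s)) (hun : ∀ s ∈ S, ¬ Serves pt η M A c s) :
    η ^ 2 * ∑ x ∈ A, D x ≤ 24 * ∑ x ∈ core pt η A c, D x ∧
      η ^ 2 * M ≤ 3 * ∑ x ∈ core pt η A c, D x ∧ 0 < ∑ x ∈ core pt η A c, D x := by
  classical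
  have hc0 := idxCost_nonneg pt A c
  have hM0 : 0 ≤ M := hc0.trans hM
  obtain ⟨s, hs, hmin⟩ := S.exists_min_image (fun s => dist (pt s) c) hS
  set Δ := dist (pt s) c with hΔ
  set G := ∑ x ∈ core pt η A c, D x with hG
  set z := idxCost pt A c with hz
  have hunS : (1 + η) * z + η * M < A.card * Δ := not_le.1 (hun s hs)
  have hm : (0 : ℝ) < A.card := by
    by_contra h
    have h0 : (A.card : ℝ) = 0 := le_antisymm (not_lt.1 h) (by positivity)
    rw [h0, zero_mul] at hunS
    nlinarith [mul_nonneg hη.le hM0, mul_nonneg hη.le hc0]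
  set E := A.card * Δ - (1 + η / 2) * z with hE
  have hE1 : η * M < E := by nlinarith [mul_nonneg hη.le hc0]
  have hE2 : η / 4 * (A.card * Δ) ≤ E := by
    have h1 : (1 - η / 4) * ((1 + η) * z) ≤ (1 - η / 4) * (A.card * Δ) := by
      apply mul_le_mul_of_nonneg_left _ (by linarith)
      nlinarith [mul_nonneg hη.le hM0]
    -- This is the slack in (1 - η/4)(1 + η) = 1 + η/2 + (η/4)(1 - η).
    have h2 : 0 ≤ η / 4 * (1 - η) * z := by
      have : 0 ≤ 1 - η := by linarith
      positivity
    nlinarith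
  have hEpos : 0 < E := lt_of_le_of_lt (mul_nonneg hη.le hM0) hE1
  have hcore : ∀ x ∈ core pt η A c, E ≤ A.card * D x := by
    intro x hx
    obtain ⟨hxA, hx⟩ := Finset.mem_filter.1 hx
    obtain ⟨s', hs', e⟩ := hD1 x hxA
    have h1 : Δ ≤ dist (pt x) c + D x := by
      refine (hmin s' hs').trans ?_
      rw [e]
      linarith [dist_triangle_left (pt s') c (pt x)]
    have h2 := mul_le_mul_of_nonneg_left h1 hm.le
    rw [hE]
    linarith
  have hGE : η * E ≤ 3 * G := by
    have h1 : ((core pt η A c).card : ℝ) * E ≤ A.card * G := by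
      rw [hG, Finset.mul_sum, ← nsmul_eq_mul]
      exact Finset.card_nsmul_le_sum _ _ _ hcore
    have h2 := mul_le_mul_of_nonneg_right (card_le_card_core pt hη hη1 A c) hEpos.le
    refine le_of_mul_le_mul_left ?_ hm
    linarith
  have hsum : ∑ x ∈ A, D x ≤ z + A.card * Δ := by
    calc ∑ x ∈ A, D x ≤ ∑ x ∈ A, (dist (pt x) c + Δ) := by
          refine Finset.sum_le_sum fun x hx => (hD2 x hx s hs).trans ?_
          exact dist_triangle_right _ _ _
      _ = _ := by rw [Finset.sum_add_distrib, Finset.sum_const, nsmul_eq_mul]; rfl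
  have hsum2 : ∑ x ∈ A, D x ≤ 2 * (A.card * Δ) := by
    nlinarith [mul_nonneg hη.le hM0, mul_nonneg hη.le hc0]
  refine ⟨?_, ?_, ?_⟩
  · have h1 : η * ∑ x ∈ A, D x ≤ 8 * E := by
      have := mul_le_mul_of_nonneg_left hsum2 hη.le
      linarith
    have := mul_le_mul_of_nonneg_left h1 hη.le
    nlinarith
  · have := mul_le_mul_of_nonneg_left hE1.le hη.le
    nlinarith
  · have := mul_pos hη hEpos
    linarith

/-- Routing through the centre gives at most z + (1+η)z + ηM ≤ (2+2η)M. -/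
theorem sum_le_of_serves {pt : ℕ → X} {η M : ℝ} (hη1 : η ≤ 1) {A : Finset ℕ} {c : X}
    (hM : idxCost pt A c ≤ M) {D : ℕ → ℝ} {s : ℕ} (hD : ∀ x ∈ A, D x ≤ dist (pt x) (pt s))
    (hs : Serves pt η M A c s) : ∑ x ∈ A, D x ≤ 4 * M := by
  have hc0 := idxCost_nonneg pt A c
  have h1 : ∑ x ∈ A, D x ≤ idxCost pt A c + A.card * dist (pt s) c := by
    calc ∑ x ∈ A, D x ≤ ∑ x ∈ A, (dist (pt x) c + dist (pt s) c) := by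
          refine Finset.sum_le_sum fun x hx => (hD x hx).trans ?_
          exact dist_triangle_right _ _ _
      _ = _ := by rw [Finset.sum_add_distrib, Finset.sum_const, nsmul_eq_mul]; rfl
  unfold Serves at hs
  nlinarith

/-- A cluster that is served by none of the points in `S`. -/
def Unserved (pt : ℕ → X) (η M : ℝ) (A : Finset ℕ) (c : X) (S : Finset ℕ) : Prop :=
  ∀ s ∈ S, ¬ Serves pt η M A c s

/-- If some cluster is unserved, then the points that serve a new cluster have a substantial part
of the total distance to the sample. -/
theorem exists_progress {pt : ℕ → X} {η M : ℝ} (hη : 0 < η) (hη1 : η ≤ 1) {k : ℕ}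
    {A : Fin k → Finset ℕ} (hA : ∀ i j, i ≠ j → Disjoint (A i) (A j)) {c : Fin k → X}
    (hM : ∀ i, idxCost pt (A i) (c i) ≤ M) {S : Finset ℕ} (hS : S.Nonempty) {D : ℕ → ℝ}
    (hD1 : ∀ i, ∀ x ∈ A i, ∃ s ∈ S, D x = dist (pt x) (pt s))
    (hD2 : ∀ i, ∀ x ∈ A i, ∀ s ∈ S, D x ≤ dist (pt x) (pt s))
    (hun : ∃ i, Unserved pt η M (A i) (c i) S) :
    ∃ B : Finset ℕ, (∀ x ∈ B, ∃ i, x ∈ A i ∧ Unserved pt η M (A i) (c i) S ∧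
        Serves pt η M (A i) (c i) x) ∧
      η ^ 2 * ∑ i, ∑ x ∈ A i, D x ≤ 36 * k * ∑ x ∈ B, D x ∧ 0 < ∑ x ∈ B, D x := by
  classical
  set U : Finset (Fin k) := Finset.univ.filter fun i => Unserved pt η M (A i) (c i) S with hU
  have hmemU : ∀ i, i ∈ U ↔ Unserved pt η M (A i) (c i) S := by simp [hU]
  obtain ⟨i₀, hi₀⟩ := hun
  have hM0 : 0 ≤ M := (idxCost_nonneg pt _ _).trans (hM i₀)
  have key := fun i (hi : i ∈ U) =>
    sum_le_core hη hη1 (hM i) hS (hD1 i) (hD2 i) ((hmemU i).1 hi)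
  set G : Fin k → ℝ := fun i => ∑ x ∈ core pt η (A i) (c i), D x with hG
  have hB : ∑ x ∈ U.biUnion (fun i => core pt η (A i) (c i)), D x = ∑ i ∈ U, G i := by
    refine Finset.sum_biUnion fun i _ j _ hij => ?_
    exact (hA i j hij).mono (Finset.filter_subset _ _) (Finset.filter_subset _ _)
  have hGle : G i₀ ≤ ∑ i ∈ U, G i :=
    Finset.single_le_sum (fun i hi => (key i hi).2.2.le) ((hmemU _).2 hi₀)
  have h0 := key i₀ ((hmemU _).2 hi₀)
  refine ⟨U.biUnion (fun i => core pt η (A i) (c i)), ?_, ?_, ?_⟩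
  · intro x hx
    obtain ⟨i, hi, hx⟩ := Finset.mem_biUnion.1 hx
    exact ⟨i, Finset.filter_subset _ _ hx, (hmemU i).1 hi, serves_of_mem_core hη hM0 hx⟩
  · rw [hB]
    have hk : (1 : ℝ) ≤ k := by exact_mod_cast (Fin.pos i₀)
    -- Allowing 4M to every cluster, served or not, makes the sum uniform. A single unserved core
    -- pays for all of these: 4kη²M ≤ 12kG for the sum G over all unserved cores, and 12k + 24 ≤
    -- 36k.
    have hterm : ∀ i, η ^ 2 * ∑ x ∈ A i, D x ≤
        4 * (η ^ 2 * M) + (if i ∈ U then 24 * G i else 0) := by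
      intro i
      split_ifs with hi
      · have : 0 ≤ η ^ 2 * M := by positivity
        linarith [(key i hi).1]
      · rw [hmemU, Unserved] at hi
        push Not at hi
        obtain ⟨s, hs, hsv⟩ := hi
        have := sum_le_of_serves hη1 (hM i) (fun x hx => hD2 i x hx s hs) hsv
        have := mul_le_mul_of_nonneg_left this (sq_nonneg η)
        linarith
    have hsum : η ^ 2 * ∑ i, ∑ x ∈ A i, D x ≤ k * (4 * (η ^ 2 * M)) + 24 * ∑ i ∈ U, G i := by
      rw [Finset.mul_sum]
      refine (Finset.sum_le_sum fun i _ => hterm i).trans ?_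
      rw [Finset.sum_add_distrib, Finset.sum_const, Finset.card_univ, Fintype.card_fin,
        nsmul_eq_mul, Finset.sum_ite_mem, Finset.univ_inter, Finset.mul_sum]
    have hpos : 0 < ∑ i ∈ U, G i := h0.2.2.trans_le hGle
    have h3 : η ^ 2 * M ≤ 3 * ∑ i ∈ U, G i := by
      have := h0.2.1
      change _ ≤ 3 * G i₀ at this
      linarith
    have h4 := mul_le_mul_of_nonneg_left h3 (show (0 : ℝ) ≤ 4 * k by positivity)
    have h5 := mul_le_mul_of_nonneg_right hk hpos.le
    nlinarith
  · rw [hB]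
    exact h0.2.2.trans_le hGle

end Progress

/-! ### Selection by random numbers -/

/-- The random numbers selecting `x` are the integers of a half-open interval of length (m+1)D(x)/W,
so rounding loses at most one per point and at most `n` altogether. -/
theorem card_selected {n m : ℕ} {D : ℕ → ℝ} (hD : ∀ x < n, 0 ≤ D x)
    (hW : 0 < ∑ x ∈ Finset.range n, D x) {B : Finset ℕ} (hB : B ⊆ Finset.range n) {y : ℕ → ℕ}
    (hy : ∀ R ≤ m, Selects n m D R (y R)) :
    (m + 1 : ℕ) * (∑ x ∈ B, D x) / (∑ x ∈ Finset.range n, D x) - n ≤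
      (((Finset.range (m + 1)).filter fun R => y R ∈ B).card : ℝ) := by
  classical
  set W := ∑ x ∈ Finset.range n, D x with hWdef
  have hpre : ∀ x ≤ n, ∑ z ∈ Finset.range x, D z ≤ W := by
    intro x hx
    refine Finset.sum_le_sum_of_subset_of_nonneg ?_ ?_
    · intro z; simp only [Finset.mem_range]; omega
    · intro z hz _
      exact hD z (Finset.mem_range.1 hz)
  have hfib : ∀ x ∈ B, ((m + 1 : ℕ) : ℝ) * D x / W - 1 ≤
      (((Finset.range (m + 1)).filter fun R => y R = x).card : ℝ) := by
    intro x hx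
    have hxn := Finset.mem_range.1 (hB hx)
    set a := ((m + 1 : ℕ) : ℝ) * (∑ z ∈ Finset.range x, D z) / W with ha
    set b := ((m + 1 : ℕ) : ℝ) * (∑ z ∈ Finset.range (x + 1), D z) / W with hb
    have hab : b - a = ((m + 1 : ℕ) : ℝ) * D x / W := by
      rw [ha, hb, Finset.sum_range_succ]; ring
    have ha0 : 0 ≤ a := by
      refine div_nonneg (mul_nonneg (by positivity) (Finset.sum_nonneg fun z hz => hD z ?_)) hW.le
      have := Finset.mem_range.1 hz
      omega
    have hbm : b ≤ (m + 1 : ℕ) := by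
      rw [hb, div_le_iff₀ hW]
      exact mul_le_mul_of_nonneg_left (hpre _ hxn) (by positivity)
    have hsub : Finset.Ico ⌈a⌉₊ ⌈b⌉₊ ⊆ (Finset.range (m + 1)).filter fun R => y R = x := by
      intro R hR
      rw [Finset.mem_Ico, Nat.ceil_le, Nat.lt_ceil] at hR
      have hRm : R < m + 1 := by exact_mod_cast hR.2.trans_le hbm
      refine Finset.mem_filter.2 ⟨Finset.mem_range.2 hRm, (hy R (by omega)).2 x hxn ?_ ?_⟩
      · exact (div_le_iff₀ hW).1 hR.1
      · exact (lt_div_iff₀ hW).1 hR.2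
    have hcard := Finset.card_le_card hsub
    rw [Nat.card_Ico] at hcard
    have h1 : (⌈a⌉₊ : ℝ) < a + 1 := Nat.ceil_lt_add_one ha0
    have h2 : b ≤ ⌈b⌉₊ := Nat.le_ceil b
    have h3 : (⌈b⌉₊ : ℝ) ≤ ((Finset.range (m + 1)).filter fun R => y R = x).card + ⌈a⌉₊ := by
      exact_mod_cast Nat.sub_le_iff_le_add.1 hcard
    linarith
  have hsum : (((Finset.range (m + 1)).filter fun R => y R ∈ B).card : ℝ) =
      ∑ x ∈ B, (((Finset.range (m + 1)).filter fun R => y R = x).card : ℝ) := by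
    rw [Finset.card_eq_sum_card_fiberwise (f := y) (t := B)
      (s := (Finset.range (m + 1)).filter fun R => y R ∈ B)
      (fun R hR => (Finset.mem_filter.1 hR).2)]
    push_cast
    refine Finset.sum_congr rfl fun x hx => ?_
    congr 2
    ext R
    simp only [Finset.mem_filter]
    constructor
    · rintro ⟨⟨h1, -⟩, h2⟩
      exact ⟨h1, h2⟩
    · rintro ⟨h1, h2⟩
      exact ⟨⟨h1, h2 ▸ hx⟩, h2⟩
  rw [hsum]
  refine le_trans ?_ (Finset.sum_le_sum hfib)
  rw [Finset.sum_sub_distrib, ← Finset.sum_div, ← Finset.mul_sum, Finset.sum_const, nsmul_eq_mul,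
    mul_one]
  have : (B.card : ℝ) ≤ n := by
    have := Finset.card_le_card hB
    rw [Finset.card_range] at this
    exact_mod_cast this
  linarith

/-! ### The potential -/

section Potential

variable {X : Type*} [MetricSpace X]

open Classical in
/-- The set of clusters that are not served by the points in `S`. -/
noncomputable def unserved (pt : ℕ → X) (η M : ℝ) {k : ℕ} (A : Fin k → Finset ℕ) (c : Fin k → X)
    (S : Finset ℕ) : Finset (Fin k) :=
  Finset.univ.filter fun i => Unserved pt η M (A i) (c i) S

theorem mem_unserved {pt : ℕ → X} {η M : ℝ} {k : ℕ} {A : Fin k → Finset ℕ} {c : Fin k → X}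
    {S : Finset ℕ} {i : Fin k} :
    i ∈ unserved pt η M A c S ↔ Unserved pt η M (A i) (c i) S := by
  simp [unserved]

/-- A bound for the probability that `j` more rounds leave one of `u` clusters unserved. -/
noncomputable def failBound (β : ℝ) (j u : ℕ) : ℝ := if u = 0 then 0 else 2 ^ u * β ^ j

theorem failBound_le {β : ℝ} (hβ : 0 ≤ β) (j : ℕ) {u v : ℕ} (huv : u ≤ v) :
    failBound β j u ≤ 2 ^ v * β ^ j := by
  unfold failBound
  split_ifs
  · positivity
  · gcongr
    norm_num

/-- With probability p ≥ η²/(72k) the new point serves a new cluster, which at least halves 2^u;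
otherwise u does not grow. The expected factor is at most 1 - p/2 ≤ 1 - η²/(144k). -/
theorem sum_failBound_le {pt : ℕ → X} {η M : ℝ} (hη : 0 < η) (hη1 : η ≤ 1) {n k m : ℕ}
    {A : Fin k → Finset ℕ} (hA : ∀ i j, i ≠ j → Disjoint (A i) (A j))
    (hAn : ∀ i, A i ⊆ Finset.range n) {c : Fin k → X}
    (hM : ∀ i, idxCost pt (A i) (c i) ≤ M) {S : Finset ℕ} (hS : S.Nonempty) {D : ℕ → ℝ}
    (hD0 : ∀ x < n, (∀ i, x ∉ A i) → D x = 0)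
    (hD1 : ∀ i, ∀ x ∈ A i, ∃ s ∈ S, D x = dist (pt x) (pt s))
    (hD2 : ∀ i, ∀ x ∈ A i, ∀ s ∈ S, D x ≤ dist (pt x) (pt s))
    {y : ℕ → ℕ} (hy : ∀ R ≤ m, Selects n m D R (y R))
    (hm : (72 * k : ℝ) * n ≤ η ^ 2 * (m + 1 : ℕ)) (j : ℕ) :
    ∑ R ∈ Finset.range (m + 1),
        failBound (1 - η ^ 2 / (144 * k)) j (unserved pt η M A c (insert (y R) S)).card ≤
      (m + 1 : ℕ) * failBound (1 - η ^ 2 / (144 * k)) (j + 1) (unserved pt η M A c S).card := by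
  classical
  set β := 1 - η ^ 2 / (144 * k) with hβ
  have hsub : ∀ x, unserved pt η M A c (insert x S) ⊆ unserved pt η M A c S := by
    intro x i hi
    rw [mem_unserved] at hi ⊢
    exact fun s hs => hi s (Finset.mem_insert_of_mem hs)
  set u := (unserved pt η M A c S).card with hu
  rcases Nat.eq_zero_or_pos u with hu0 | hupos
  · have : ∀ x, (unserved pt η M A c (insert x S)).card = 0 := by
      intro x
      have := Finset.card_le_card (hsub x)
      omega
    simp [this, hu0, failBound]
  obtain ⟨i₀, hi₀⟩ := Finset.card_pos.1 hupos
  have hk : 0 < k := Fin.pos i₀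
  have hk' : (1 : ℝ) ≤ k := by exact_mod_cast hk
  have hβ0 : 0 ≤ β := by
    rw [hβ, sub_nonneg, div_le_one (by positivity)]
    nlinarith
  obtain ⟨B, hB, hBW, hBpos⟩ := exists_progress hη hη1 hA hM hS hD1 hD2 ⟨i₀, mem_unserved.1 hi₀⟩
  have hDnn : ∀ x < n, 0 ≤ D x := by
    intro x hx
    by_cases h : ∀ i, x ∉ A i
    · exact (hD0 x hx h).ge
    · push Not at h
      obtain ⟨i, hi⟩ := h
      obtain ⟨s, -, e⟩ := hD1 i x hi
      rw [e]
      exact dist_nonneg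
  have hBn : B ⊆ Finset.range n := fun x hx => by
    obtain ⟨i, hi, -⟩ := hB x hx
    exact hAn i hi
  have hWsum : ∑ x ∈ Finset.range n, D x = ∑ i, ∑ x ∈ A i, D x := by
    rw [← Finset.sum_biUnion fun i _ j _ hij => hA i j hij]
    symm
    refine Finset.sum_subset (Finset.biUnion_subset.2 fun i _ => hAn i) fun x hx hx' => ?_
    refine hD0 x (Finset.mem_range.1 hx) fun i hi => hx' ?_
    exact Finset.mem_biUnion.2 ⟨i, Finset.mem_univ _, hi⟩
  rw [← hWsum] at hBW
  have hW : 0 < ∑ x ∈ Finset.range n, D x :=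
    hBpos.trans_le (Finset.sum_le_sum_of_subset_of_nonneg hBn
      fun x hx _ => hDnn x (Finset.mem_range.1 hx))
  have hcard := card_selected hDnn hW hBn hy
  set H := (Finset.range (m + 1)).filter fun R => y R ∈ B with hH
  set W := ∑ x ∈ Finset.range n, D x with hWd
  set G := ∑ x ∈ B, D x with hGd
  -- By `hm`, the rounding loss `n` is at most half of the guaranteed share η²/(36k) of the draws.
  have hHc : ((m + 1 : ℕ) : ℝ) * (η ^ 2 / (72 * k)) ≤ H.card := by
    refine le_trans ?_ hcard
    have h1 : η ^ 2 / (36 * k) ≤ G / W := by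
      rw [div_le_div_iff₀ (by positivity) hW]
      linarith
    have h2 : ((m + 1 : ℕ) : ℝ) * (η ^ 2 / (36 * k)) ≤ (m + 1 : ℕ) * G / W := by
      rw [mul_div_assoc]
      exact mul_le_mul_of_nonneg_left h1 (by positivity)
    have h3 : (n : ℝ) ≤ (m + 1 : ℕ) * (η ^ 2 / (72 * k)) := by
      rw [← mul_div_assoc, le_div_iff₀ (by positivity)]
      linarith
    have h4 : ((m + 1 : ℕ) : ℝ) * (η ^ 2 / (36 * k)) =
        (m + 1 : ℕ) * (η ^ 2 / (72 * k)) + (m + 1 : ℕ) * (η ^ 2 / (72 * k)) := by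
      field_simp; ring
    linarith
  have hterm : ∀ R ∈ Finset.range (m + 1),
      failBound β j (unserved pt η M A c (insert (y R) S)).card ≤
        2 ^ u * β ^ j - if R ∈ H then 2 ^ u * β ^ j / 2 else 0 := by
    intro R hR
    split_ifs with hRH
    · obtain ⟨i, -, hi, hsv⟩ := hB _ (Finset.mem_filter.1 hRH).2
      have hlt : (unserved pt η M A c (insert (y R) S)).card < u := by
        refine Finset.card_lt_card ⟨hsub _, fun h => ?_⟩
        have := mem_unserved.1 (h (mem_unserved.2 hi))
        exact this _ (Finset.mem_insert_self _ _) hsv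
      refine (failBound_le hβ0 j (Nat.le_sub_one_of_lt hlt)).trans (le_of_eq ?_)
      obtain ⟨v, hv⟩ : ∃ v, u = v + 1 := ⟨u - 1, by omega⟩
      rw [hv, Nat.add_sub_cancel, pow_succ]
      ring
    · rw [sub_zero]
      exact failBound_le hβ0 j (Finset.card_le_card (hsub _))
  refine (Finset.sum_le_sum hterm).trans ?_
  rw [Finset.sum_sub_distrib, Finset.sum_const, Finset.card_range, nsmul_eq_mul,
    Finset.sum_ite_mem, Finset.inter_eq_right.2 (Finset.filter_subset _ _), Finset.sum_const,
    nsmul_eq_mul, failBound, if_neg hupos.ne', pow_succ]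
  have hnn : 0 ≤ 2 ^ u * β ^ j / 2 := by positivity
  have h5 := mul_le_mul_of_nonneg_right hHc hnn
  have h6 : ((m + 1 : ℕ) : ℝ) * (2 ^ u * (β ^ j * β)) = (m + 1 : ℕ) * (2 ^ u * β ^ j) -
      (m + 1 : ℕ) * (η ^ 2 / (72 * k)) * (2 ^ u * β ^ j / 2) := by
    rw [show (2 : ℝ) ^ u * (β ^ j * β) = 2 ^ u * β ^ j * β by ring]
    nth_rewrite 2 [hβ]
    field_simp
    ring
  linarith

end Potential

/-! ## The sampling loop -/

/-- The memory before round `i`. -/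
structure LoopInv (O : Oracle) (n k N i : ℕ) (σ : State) : Prop where
  points : σ.nvar 0 = n
  clusters : σ.nvar 1 = k
  len : σ.nvar 2 = 0
  rounds : σ.nvar 3 = N
  bound : σ.nvar 4 = n * N
  round : σ.nvar 6 = i
  latest : σ.nvar 7 = σ.narr 1 i
  cand : σ.nvar 10 = 0
  wpos : σ.nvar 14 = 0
  cur : σ.nvar 15 = 0
  rpos : σ.nvar 16 = 0
  marks : σ.narr 3 = fun _ => 0
  samples : ∀ j ≤ i, σ.narr 1 j < n
  dist_eq : ∀ x < n, O.isClient x → ∃ j ≤ i, σ.rarr 0 x = O.dist x (σ.narr 1 j)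
  dist_le : ∀ x < n, O.isClient x → ∀ j < i, σ.rarr 0 x ≤ O.dist x (σ.narr 1 j)
  dist_other : ∀ x < n, ¬ O.isClient x → σ.rarr 0 x = 0

theorem Ready.loopInv {O : Oracle} {n k N : ℕ} {σ : State} (hn : 0 < n) (h : Ready O n k N σ) :
    LoopInv O n k N 0 σ where
  points := h.points
  clusters := h.clusters
  len := h.len
  rounds := h.rounds
  bound := h.bound
  round := h.round
  latest := by rw [h.latest, h.samples]
  cand := h.cand
  wpos := h.wpos
  cur := h.cur
  rpos := h.rpos
  marks := h.marks
  samples := fun j _ => by rw [h.samples]; exact hn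
  dist_eq := fun x hx hc => ⟨0, le_rfl, by rw [h.samples]; exact h.dist_client x hx hc⟩
  dist_le := fun x _ _ j hj => by omega
  dist_other := h.dist_other

/-- The points sampled before round `i`. -/
def sampleSet (i : ℕ) (σ : State) : Finset ℕ := (Finset.range (i + 1)).image (σ.narr 1)

theorem mem_sampleSet {i : ℕ} {σ : State} {s : ℕ} : s ∈ sampleSet i σ ↔ ∃ j ≤ i, σ.narr 1 j = s := by
  simp [sampleSet]

/-- `D` is the distance to the set `S` on clients, and zero on the other points. -/
structure IsDistTo (O : Oracle) (n : ℕ) (S : Finset ℕ) (D : ℕ → ℝ) : Prop where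
  eq : ∀ x < n, O.isClient x → ∃ s ∈ S, D x = O.dist x s
  le : ∀ x < n, O.isClient x → ∀ s ∈ S, D x ≤ O.dist x s
  other : ∀ x < n, ¬ O.isClient x → D x = 0

/-- `Φ` is a bound for a failure probability that is consistent with one round of sampling:
`Φ j S` bounds the probability of a failure when `j` rounds remain and the sample is `S`. -/
def IsPotential (O : Oracle) (n m : ℕ) (Φ : ℕ → Finset ℕ → ℝ) : Prop :=
  ∀ (j : ℕ) (S : Finset ℕ) (D : ℕ → ℝ) (y : ℕ → ℕ), S.Nonempty → (∀ s ∈ S, s < n) →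
    IsDistTo O n S D → (∀ R ≤ m, Selects n m D R (y R)) →
    ∑ R ∈ Finset.range (m + 1), Φ j (insert (y R) S) ≤ (m + 1 : ℕ) * Φ (j + 1) S

/-- By induction on the remaining rounds, success has probability at least 1 minus the potential:
averaging over the next draw is the inequality in `IsPotential`. -/
theorem likely_sampling {O : Oracle} (hO : ∀ i j, 0 ≤ O.dist i j) {n k N : ℕ} (hn : 0 < n)
    {Φ : ℕ → Finset ℕ → ℝ} (hΦ : IsPotential O n (n * N) Φ) {S : Set Config} {K : List Prog}
    {t : ℕ} (hK : ∀ σ, LoopInv O n k N N σ → Likely O S t (K, σ) (1 - Φ 0 (sampleSet N σ)))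
    (j : ℕ) : ∀ (i : ℕ) (σ : State), i + j = N → LoopInv O n k N i σ →
      Likely O S (j * (n * 16 + 20) + 1 + t) (sampling :: K, σ) (1 - Φ j (sampleSet i σ)) := by
  induction j with
  | zero =>
    intro i σ hi h
    obtain rfl : i = N := by omega
    refine (Likely.while_false ?_ (hK σ h)).mono (by omega) le_rfl
    simp [BExp.Holds, NExp.eval, h.round, h.rounds]
  | succ j ih =>
    intro i σ hi h
    have hnm : (j + 1) * (n * 16 + 20) = j * (n * 16 + 20) + n * 16 + 20 := by ring
    refine Likely.mono (Likely.while_true ?_ (Likely.seq (Likely.ex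
      (s := n * 8 + 5) (t := j * (n * 16 + 20) + 1 + t + (n * 8 + 11) + 2)
      (ex_updateDist O h.points h.latest) ?_))) (by omega) le_rfl
    · simp only [BExp.Holds, NExp.eval, h.round, h.rounds]
      omega
    rintro σ₁ f₁ ⟨hD, hW⟩
    -- The latest sample enters the distances only at the start of the round. This is why `dist_le`
    -- covers `j < i` but `dist_eq` allows `j ≤ i`.
    have hdist : IsDistTo O n (sampleSet i σ) (σ₁.rarr 0) := by
      constructor
      · intro x hx hc
        rw [hD x hx]
        rcases min_choice (σ.rarr 0 x) (O.dist x (σ.narr 1 i)) with e | e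
        · obtain ⟨j', hj', e'⟩ := h.dist_eq x hx hc
          exact ⟨_, mem_sampleSet.2 ⟨j', hj', rfl⟩, by rw [e, e']⟩
        · exact ⟨_, mem_sampleSet.2 ⟨i, le_rfl, rfl⟩, e⟩
      · intro x hx hc s hs
        obtain ⟨j', hj', rfl⟩ := mem_sampleSet.1 hs
        rw [hD x hx]
        rcases hj'.lt_or_eq with hlt | rfl
        · exact (min_le_left _ _).trans (h.dist_le x hx hc j' hlt)
        · exact min_le_right _ _
      · intro x hx hc
        rw [hD x hx, h.dist_other x hx hc, min_eq_left (hO _ _)]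
    have hnn : ∀ x < n, 0 ≤ σ₁.rarr 0 x := by
      intro x hx
      by_cases hc : O.isClient x
      · obtain ⟨s, -, e⟩ := hdist.eq x hx hc
        rw [e]
        exact hO _ _
      · exact (hdist.other x hx hc).ge
    have hm : σ₁.nvar 4 = n * N := by rw [f₁.n 4 rfl, h.bound]
    have hround : ∀ R, ∃ y, R ≤ n * N → Selects n (n * N) (σ₁.rarr 0) R y ∧
        Likely O S (j * (n * 16 + 20) + 1 + t + (n * 8 + 11))
          (selectSample :: sampling :: K, σ₁.setN 8 R) (1 - Φ j (insert y (sampleSet i σ))) := by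
      intro R
      have hE := ex_selectSample O (n := n) (m := n * N) (R := R) (i := i) (σ := σ₁.setN 8 R) hn
        (by simp [State.setN, f₁.n 0 rfl, h.points]) (by simp [State.setN, hm])
        (by simp [State.setN]) (by simp [State.setN, f₁.n 6 rfl, h.round]) hnn hW
      obtain ⟨τ, hτ, σ₂, hB, hsel, h6, h1⟩ := hE
      refine ⟨σ₂.nvar 7, fun hR => ⟨hsel, ?_⟩⟩
      have f₂ := hB.frame
      have hn2 : ∀ x, x ≠ 8 → updateDist.wN x = false → selectSample.wN x = false →
          σ₂.nvar x = σ.nvar x := by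
        intro x hx8 hx hx'
        rw [f₂.n x hx', ← f₁.n x hx]
        simp [State.setN, hx8]
      have h1' : σ₂.narr 1 = Function.update (σ.narr 1) (i + 1) (σ₂.nvar 7) := by
        rw [h1, ← f₁.na 1 rfl]; rfl
      have hold : ∀ j' ≤ i, σ₂.narr 1 j' = σ.narr 1 j' := fun j' hj' => by
        rw [h1', Function.update_of_ne (by omega)]
      have hra : σ₂.rarr 0 = σ₁.rarr 0 := f₂.ra 0 rfl
      have hset : sampleSet (i + 1) σ₂ = insert (σ₂.nvar 7) (sampleSet i σ) := by
        ext s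
        rw [Finset.mem_insert, mem_sampleSet, mem_sampleSet]
        constructor
        · rintro ⟨j', hj', rfl⟩
          rcases Nat.le_succ_iff.1 hj' with hj' | rfl
          · exact Or.inr ⟨j', hj', (hold j' hj').symm⟩
          · left; rw [h1', Function.update_self]
        · rintro (rfl | ⟨j', hj', rfl⟩)
          · exact ⟨i + 1, le_rfl, by rw [h1', Function.update_self]⟩
          · exact ⟨j', by omega, hold j' hj'⟩
      have hinv : LoopInv O n k N (i + 1) σ₂ := by
        constructor
        case points => rw [hn2 _ (by decide) rfl rfl, h.points]
        case clusters => rw [hn2 _ (by decide) rfl rfl, h.clusters]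
        case len => rw [hn2 _ (by decide) rfl rfl, h.len]
        case rounds => rw [hn2 _ (by decide) rfl rfl, h.rounds]
        case bound => rw [hn2 _ (by decide) rfl rfl, h.bound]
        case round => exact h6
        case latest => rw [h1', Function.update_self]
        case cand => rw [hn2 _ (by decide) rfl rfl, h.cand]
        case wpos => rw [hn2 _ (by decide) rfl rfl, h.wpos]
        case cur => rw [hn2 _ (by decide) rfl rfl, h.cur]
        case rpos => rw [hn2 _ (by decide) rfl rfl, h.rpos]
        case marks =>
          rw [f₂.na 3 rfl]
          change σ₁.narr 3 = _
          rw [f₁.na 3 rfl, h.marks]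
        case samples =>
          intro j' hj'
          rcases Nat.le_succ_iff.1 hj' with hj' | rfl
          · rw [hold j' hj']; exact h.samples j' hj'
          · rw [h1', Function.update_self]; exact hsel.1
        case dist_eq =>
          intro x hx hc
          obtain ⟨s, hs, e⟩ := hdist.eq x hx hc
          obtain ⟨j', hj', rfl⟩ := mem_sampleSet.1 hs
          exact ⟨j', by omega, by rw [hra, e, hold j' hj']⟩
        case dist_le =>
          intro x hx hc j' hj'
          rw [hra, hold j' (by omega)]
          exact hdist.le x hx hc _ (mem_sampleSet.2 ⟨j', by omega, rfl⟩)
        case dist_other =>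
          intro x hx hc
          rw [hra]
          exact hdist.other x hx hc
      rw [← hset]
      exact (Likely.big hB (ih (i + 1) σ₂ (by omega) hinv)).mono (by omega) le_rfl
    -- Everything after the draw is deterministic up to the next round, so the new sample is a
    -- function of the random number.
    choose y hy using hround
    refine (Likely.seq (Likely.rand (m := n * N) (σ := σ₁) (e := .var 4) hm
      (fun R => 1 - Φ j (insert (y R) (sampleSet i σ))) fun R hR => (hy R hR).2)).mono
      (by omega) ?_
    have hpot := hΦ j (sampleSet i σ) (σ₁.rarr 0) y ⟨_, mem_sampleSet.2 ⟨i, le_rfl, rfl⟩⟩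
      (fun s hs => by
        obtain ⟨j', hj', rfl⟩ := mem_sampleSet.1 hs
        exact h.samples j' hj') hdist (fun R hR => (hy R hR).1)
    have hpos : (0 : ℝ) < (n * N + 1 : ℕ) := by positivity
    rw [le_div_iff₀ hpos, Finset.sum_sub_distrib, Finset.sum_const, Finset.card_range, nsmul_eq_mul]
    linarith

/-- The memory after halting: the output consists of all tuples of candidates, and the candidates
are facilities near the samples. -/
structure Finished (O : Oracle) (n k N : ℕ) (σ : State) : Prop where
  len : σ.nvar 2 = ((N + 1) * k) ^ k
  out : ∀ t < ((N + 1) * k) ^ k, ∀ j < k,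
    σ.narr 0 (t * k + j) = σ.narr 2 (t / ((N + 1) * k) ^ j % ((N + 1) * k))
  samples : ∀ i < N + 1, σ.narr 1 i < n
  near : ∀ i < N + 1, Near O k (σ.narr 2) (i * k) (σ.narr 1 i)

/-- A bound for the running time. -/
def timeBound (n k N : ℕ) : ℕ :=
  N * (n * 16 + 22) + n * 10 + (N + 1) * (k * (n * 8 + 14) + 6) +
    ((N + 1) * k) ^ k * (k * 8 + 18) + k * 4 + 50

/-- The program halts in time; the samples then have property `G`, except with a probability
bounded by the potential of the initial sample. -/
theorem likely_program {O : Oracle} (hO : ∀ i j, 0 ≤ O.dist i j) {n k : ℕ} {ε : ℝ} (hn : 0 < n)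
    (hk : 0 < k) (hε : 0 < ε) (hF : ∀ x, O.isFacility x → x < n) (hne : ∃ f, O.isFacility f)
    {Φ : ℕ → Finset ℕ → ℝ} (hΦ : IsPotential O n (n * numRounds k ε) Φ) {G : Finset ℕ → Prop}
    (hΦ0 : ∀ S, 0 ≤ Φ 0 S) (hG : ∀ S, ¬ G S → 1 ≤ Φ 0 S) :
    Likely O {cfg | cfg.1 = [] ∧ Finished O n k (numRounds k ε) cfg.2 ∧
        G (sampleSet (numRounds k ε) cfg.2)}
      (timeBound n k (numRounds k ε)) ([program], initState n k ε)
      (1 - Φ (numRounds k ε) {0}) := by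
  obtain ⟨κ, rfl⟩ : ∃ κ, k = κ + 1 := ⟨k - 1, by omega⟩
  set N := numRounds (κ + 1) ε with hN
  set S : Set Config := {cfg | cfg.1 = [] ∧ Finished O n (κ + 1) N cfg.2 ∧ G (sampleSet N cfg.2)}
    with hS
  set q := (N + 1) * (κ + 1) with hq
  have hpost : ∀ σ, LoopInv O n (κ + 1) N N σ →
      Likely O S ((N + 1) * ((κ + 1) * (n * 8 + 14) + 6) + 5 +
        (q ^ (κ + 1) * (κ * 8 + 18) + κ * 4 + 13) + 1)
        ([.seq collect writeTuples], σ) (1 - Φ 0 (sampleSet N σ)) := by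
    intro σ h
    by_cases hGσ : G (sampleSet N σ)
    swap
    -- For a bad final sample the claimed lower bound is not positive.
    · intro T _
      exact (sub_nonpos.2 (hG _ hGσ)).trans (prob_nonneg _ _ _ _)
    refine Likely.mono (Likely.seq (Likely.ex
      (ex_collect O hF hne h.points h.clusters h.rounds h.cand h.marks) ?_)) le_rfl
      (sub_le_self _ (hΦ0 _))
    rintro σ₁ f₁ ⟨h10, hnear⟩
    refine (Likely.ex (t := 0) (ex_writeTuples O (q := q) (κ := κ) (σ := σ₁) (by positivity)
      (by rw [f₁.n 1 rfl, h.clusters]) (by rw [f₁.n 2 rfl, h.len]) h10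
      (by rw [f₁.n 14 rfl, h.wpos]) (by rw [f₁.n 15 rfl, h.cur])
      (by rw [f₁.n 16 rfl, h.rpos])) ?_).mono le_rfl le_rfl
    rintro σ₂ f₂ ⟨h2, hout⟩
    have e1 : σ₂.narr 1 = σ.narr 1 := by rw [f₂.na 1 rfl, f₁.na 1 rfl]
    have e2 : σ₂.narr 2 = σ₁.narr 2 := f₂.na 2 rfl
    refine Likely.halted (show (([], σ₂) : Config) ∈ S from ⟨rfl, ⟨h2, ?_, ?_, ?_⟩, ?_⟩) 0
    · intro t ht j hj
      rw [e2]
      exact hout t ht j hj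
    · intro i hi
      rw [e1]
      exact h.samples i (by omega)
    · intro i hi
      rw [e1, e2]
      exact hnear i hi
    · simpa only [sampleSet, e1] using hGσ
  have hsam := likely_sampling hO hn hΦ hpost N
  refine Likely.mono (Likely.seq (Likely.ex (ex_setup O hε) (t := N * (n * 16 + 20) + 1 +
    ((N + 1) * ((κ + 1) * (n * 8 + 14) + 6) + 5 +
        (q ^ (κ + 1) * (κ * 8 + 18) + κ * 4 + 13) + 1) + 1)
    (q := 1 - Φ N {0}) ?_)) ?_ le_rfl
  · intro σ _ h
    have h0 : sampleSet 0 σ = {0} := by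
      ext s
      rw [mem_sampleSet, h.samples]
      simp [eq_comm]
    have := hsam 0 σ (by omega) (h.loopInv hn)
    rw [h0] at this
    exact Likely.seq this
  · unfold timeBound
    rw [← hq, ← hN]
    have h1 : q ^ (κ + 1) * (κ * 8 + 18) ≤ q ^ (κ + 1) * ((κ + 1) * 8 + 18) :=
      Nat.mul_le_mul_left _ (by omega)
    have h2 : N * (n * 16 + 22) = N * (n * 16 + 20) + N * 2 := by ring
    omega

/-! ## From indices to points -/

theorem IsPartition.subset {X : Type*} {P : Finset X} {k : ℕ} {O : Fin k → Finset X}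
    (hO : IsPartition P O) (i : Fin k) : O i ⊆ P := fun x hx => (hO.2 x).2 ⟨i, hx⟩

section Numbering

variable {X : Type*} [DecidableEq X] {P F : Finset X}

/-- The point with number `i`, and `x₀` if `i` is out of range. -/
def point (pts : Fin (P ∪ F).card ≃ {x // x ∈ P ∪ F}) (x₀ : X) (i : ℕ) : X :=
  if h : i < (P ∪ F).card then pts ⟨i, h⟩ else x₀

variable (pts : Fin (P ∪ F).card ≃ {x // x ∈ P ∪ F}) (x₀ : X)

theorem point_of_lt {i : ℕ} (h : i < (P ∪ F).card) : point pts x₀ i = pts ⟨i, h⟩ := dif_pos h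

theorem point_injOn {i j : ℕ} (hi : i < (P ∪ F).card) (hj : j < (P ∪ F).card)
    (h : point pts x₀ i = point pts x₀ j) : i = j := by
  rw [point_of_lt pts x₀ hi, point_of_lt pts x₀ hj] at h
  simpa using pts.injective (Subtype.ext h)

theorem exists_point {x : X} (hx : x ∈ P ∪ F) : ∃ i < (P ∪ F).card, point pts x₀ i = x := by
  refine ⟨pts.symm ⟨x, hx⟩, (pts.symm ⟨x, hx⟩).2, ?_⟩
  rw [point_of_lt pts x₀ (pts.symm ⟨x, hx⟩).2]
  simp

/-- The numbers of the points in `A`. -/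
def indices (A : Finset X) : Finset ℕ :=
  (Finset.range (P ∪ F).card).filter fun i => point pts x₀ i ∈ A

theorem mem_indices {A : Finset X} {i : ℕ} :
    i ∈ indices pts x₀ A ↔ i < (P ∪ F).card ∧ point pts x₀ i ∈ A := by
  simp [indices]

end Numbering

section Input

variable {X : Type*} [MetricSpace X] [DecidableEq X] {P F : Finset X}
  (pts : Fin (P ∪ F).card ≃ {x // x ∈ P ∪ F}) (x₀ : X)

theorem inputOracle_dist {i j : ℕ} (hi : i < (P ∪ F).card) (hj : j < (P ∪ F).card) :
    (inputOracle P F pts).dist i j = dist (point pts x₀ i) (point pts x₀ j) := by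
  simp [inputOracle, hi, hj, point]

theorem inputOracle_dist_nonneg (i j : ℕ) : 0 ≤ (inputOracle P F pts).dist i j := by
  simp only [inputOracle]
  split_ifs
  · exact dist_nonneg
  · exact le_rfl

theorem inputOracle_isClient {i : ℕ} :
    (inputOracle P F pts).isClient i ↔ i < (P ∪ F).card ∧ point pts x₀ i ∈ P := by
  constructor
  · rintro ⟨h, h'⟩
    exact ⟨h, by rwa [point_of_lt pts x₀ h]⟩
  · rintro ⟨h, h'⟩
    exact ⟨h, by rwa [point_of_lt pts x₀ h] at h'⟩

theorem inputOracle_isFacility {i : ℕ} :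
    (inputOracle P F pts).isFacility i ↔ i < (P ∪ F).card ∧ point pts x₀ i ∈ F := by
  constructor
  · rintro ⟨h, h'⟩
    exact ⟨h, by rwa [point_of_lt pts x₀ h]⟩
  · rintro ⟨h, h'⟩
    exact ⟨h, by rwa [point_of_lt pts x₀ h] at h'⟩

theorem idxCost_indices {A : Finset X} (hA : A ⊆ P) (c : X) :
    idxCost (point pts x₀) (indices pts x₀ A) c = clusterCost c A := by
  refine Finset.sum_nbij (point pts x₀) (fun i hi => ((mem_indices pts x₀).1 hi).2) ?_ ?_
    (fun _ _ => rfl)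
  · intro i hi j hj h
    exact point_injOn pts x₀ ((mem_indices pts x₀).1 hi).1 ((mem_indices pts x₀).1 hj).1 h
  · intro x hx
    obtain ⟨i, hi, rfl⟩ := exists_point pts x₀ (Finset.mem_union_left F (hA hx))
    exact ⟨i, (mem_indices pts x₀).2 ⟨hi, hx⟩, rfl⟩

end Input

/-! ### The number of rounds suffices -/

theorem le_numRounds {k : ℕ} {ε : ℝ} (hε : 0 < ε) :
    4608 * (k : ℝ) ^ 2 ≤ ε ^ 2 * numRounds k ε := by
  have := Nat.le_ceil (4608 * (k : ℝ) ^ 2 / ε ^ 2)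
  rw [div_le_iff₀ (by positivity)] at this
  rw [numRounds]
  linarith

theorem failBound_numRounds_le {k : ℕ} {ε : ℝ} (hk : 0 < k) (hε : 0 < ε) (hε1 : ε < 1) {u : ℕ}
    (hu : u ≤ k) : failBound (1 - (ε / 4) ^ 2 / (144 * k)) (numRounds k ε) u ≤ 1 / 2 := by
  have hk' : (1 : ℝ) ≤ k := by exact_mod_cast hk
  set z := (ε / 4) ^ 2 / (144 * k) with hz
  have hz1 : 0 ≤ 1 - z := by
    rw [hz, sub_nonneg, div_le_one (by positivity)]
    nlinarith
  refine (failBound_le hz1 _ hu).trans ?_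
  -- Here z = ε²/(2304k), and 4608 = 2 · 2304. Then (1-z)^N ≤ e^(-2k) ≤ 4^(-k), which beats the
  -- factor 2^k.
  have hNz : 2 * (k : ℝ) ≤ numRounds k ε * z := by
    rw [hz, ← mul_div_assoc, le_div_iff₀ (by positivity)]
    nlinarith [le_numRounds (k := k) hε]
  have h4 : Real.exp (-2) ≤ 1 / 4 := by
    have h2 : (2 : ℝ) ≤ Real.exp 1 := by linarith [Real.add_one_le_exp (1 : ℝ)]
    have : (4 : ℝ) ≤ Real.exp 2 := by
      rw [show (2 : ℝ) = 1 + 1 by norm_num, Real.exp_add]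
      nlinarith
    rw [Real.exp_neg, one_div]
    exact inv_anti₀ (by norm_num) this
  have h1 : (1 - z) ^ numRounds k ε ≤ (1 / 4) ^ k := by
    calc (1 - z) ^ numRounds k ε ≤ Real.exp (-z) ^ numRounds k ε :=
          pow_le_pow_left₀ hz1 (Real.one_sub_le_exp_neg z) _
      _ = Real.exp (-(numRounds k ε * z)) := by rw [← Real.exp_nat_mul]; ring_nf
      _ ≤ Real.exp (k * (-2)) := Real.exp_le_exp.2 (by linarith)
      _ = Real.exp (-2) ^ k := Real.exp_nat_mul _ _
      _ ≤ _ := pow_le_pow_left₀ (Real.exp_pos _).le h4 _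
  calc (2 : ℝ) ^ k * (1 - z) ^ numRounds k ε ≤ 2 ^ k * (1 / 4) ^ k := by gcongr
    _ = (1 / 2) ^ k := by rw [← mul_pow]; norm_num
    _ ≤ (1 / 2) ^ 1 := pow_le_pow_of_le_one (by norm_num) (by norm_num) hk
    _ = 1 / 2 := pow_one _

section Input

variable {X : Type*} [MetricSpace X] [DecidableEq X] {P F : Finset X}

theorem isPotential_failBound (pts : Fin (P ∪ F).card ≃ {x // x ∈ P ∪ F}) (x₀ : X) {k : ℕ} {ε : ℝ}
    (hk : 0 < k) (hε : 0 < ε) (hε1 : ε < 1) {O : Fin k → Finset X} (hO : IsPartition P O)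
    {c : Fin k → X} {M : ℝ} (hM : ∀ i, clusterCost (c i) (O i) ≤ M) :
    IsPotential (inputOracle P F pts) (P ∪ F).card ((P ∪ F).card * numRounds k ε) fun j S =>
      failBound (1 - (ε / 4) ^ 2 / (144 * k)) j
        (unserved (point pts x₀) (ε / 4) M (fun i => indices pts x₀ (O i)) c S).card := by
  intro j S D y hS hSn hD hy
  have hcl : ∀ i, ∀ x ∈ indices pts x₀ (O i),
      x < (P ∪ F).card ∧ (inputOracle P F pts).isClient x := by
    intro i x hx
    obtain ⟨h1, h2⟩ := (mem_indices pts x₀).1 hx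
    exact ⟨h1, (inputOracle_isClient pts x₀).2 ⟨h1, hO.subset i h2⟩⟩
  refine sum_failBound_le (n := (P ∪ F).card) (by positivity) (by linarith) ?_ ?_ ?_ hS ?_ ?_ ?_
    hy ?_ j
  · intro i i' hii
    rw [Finset.disjoint_left]
    intro x hx hx'
    exact Finset.disjoint_left.1 (hO.1 i i' hii) ((mem_indices pts x₀).1 hx).2
      ((mem_indices pts x₀).1 hx').2
  · exact fun i => Finset.filter_subset _ _
  · intro i
    rw [idxCost_indices pts x₀ (hO.subset i)]
    exact hM i
  · intro x hx hxA
    refine hD.other x hx fun hc => ?_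
    obtain ⟨i, hi⟩ := (hO.2 _).1 ((inputOracle_isClient pts x₀).1 hc).2
    exact hxA i ((mem_indices pts x₀).2 ⟨hx, hi⟩)
  · intro i x hx
    obtain ⟨h1, h2⟩ := hcl i x hx
    obtain ⟨s, hs, e⟩ := hD.eq x h1 h2
    exact ⟨s, hs, by rw [e, inputOracle_dist pts x₀ h1 (hSn s hs)]⟩
  · intro i x hx s hs
    obtain ⟨h1, h2⟩ := hcl i x hx
    rw [← inputOracle_dist pts x₀ h1 (hSn s hs)]
    exact hD.le x h1 h2 s hs
  · have hk' : (1 : ℝ) ≤ k := by exact_mod_cast hk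
    have h1 := le_numRounds (k := k) hε
    -- With 4608/16 = 288, the right side is at least 288k². Thus random draws bounded by `n` times
    -- the number of rounds are fine enough.
    have h2 : 72 * (k : ℝ) ≤ (ε / 4) ^ 2 * numRounds k ε := by nlinarith
    have h3 := mul_le_mul_of_nonneg_right h2 (Nat.cast_nonneg (α := ℝ) (P ∪ F).card)
    have h4 : 0 ≤ (ε / 4) ^ 2 := by positivity
    push_cast
    nlinarith

/-! ## The output -/

/-- The list of tuples held in memory after halting. -/
def outputList (pts : Fin (P ∪ F).card ≃ {x // x ∈ P ∪ F}) (x₀ : X) (k N : ℕ) (σ : State) :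
    List (Fin k → X) :=
  List.ofFn fun (t : Fin (((N + 1) * k) ^ k)) (j : Fin k) => point pts x₀ (σ.narr 0 (t * k + j))

variable {pts : Fin (P ∪ F).card ≃ {x // x ∈ P ∪ F}} (x₀ : X) {k N : ℕ} {σ : State}

theorem Finished.isFacility (hk : 0 < k)
    (h : Finished (inputOracle P F pts) (P ∪ F).card k N σ) {q : ℕ} (hq : q < (N + 1) * k) :
    (inputOracle P F pts).isFacility (σ.narr 2 q) := by
  have hdiv : q / k < N + 1 := Nat.div_lt_of_lt_mul (by rwa [mul_comm])
  have := (h.near (q / k) hdiv).1 (q % k) (Nat.mod_lt _ hk)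
  rwa [mul_comm, Nat.div_add_mod] at this

theorem Finished.out_isFacility (hk : 0 < k)
    (h : Finished (inputOracle P F pts) (P ∪ F).card k N σ) {t : ℕ} (ht : t < ((N + 1) * k) ^ k)
    (j : Fin k) : (inputOracle P F pts).isFacility (σ.narr 0 (t * k + j)) := by
  rw [h.out t ht j j.2]
  exact h.isFacility hk (Nat.mod_lt _ (by positivity))

theorem Finished.encodes (hk : 0 < k) (h : Finished (inputOracle P F pts) (P ∪ F).card k N σ) :
    Encodes pts σ (outputList pts x₀ k N σ) := by
  refine ⟨by rw [h.len, outputList, List.length_ofFn], fun t ht j => ?_⟩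
  rw [outputList, List.length_ofFn] at ht
  have hf := ((inputOracle_isFacility pts x₀).1 (h.out_isFacility hk ht j)).1
  refine ⟨hf, ?_⟩
  rw [← point_of_lt pts x₀ hf]
  have hget := List.getElem_ofFn (f := fun (t : Fin (((N + 1) * k) ^ k)) (j : Fin k) =>
    point pts x₀ (σ.narr 0 (t * k + j))) (i := t) (by rwa [List.length_ofFn])
  exact (congrFun hget j).symm

theorem Finished.mem_facilities (hk : 0 < k)
    (h : Finished (inputOracle P F pts) (P ∪ F).card k N σ) :
    ∀ C ∈ outputList pts x₀ k N σ, ∀ j, C j ∈ F := by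
  intro C hC j
  obtain ⟨t, rfl⟩ := List.mem_ofFn.1 hC
  exact ((inputOracle_isFacility pts x₀).1 (h.out_isFacility hk t.2 j)).2

theorem Finished.mem_outputList (h : Finished (inputOracle P F pts) (P ∪ F).card k N σ)
    (d : Fin k → ℕ) (hd : ∀ j, d j < (N + 1) * k) :
    (fun j => point pts x₀ (σ.narr 2 (d j))) ∈ outputList pts x₀ k N σ := by
  -- The tuple with candidate numbers `d` stands at the position whose base-`(N + 1) * k` digits are
  -- `d`, lowest first.
  refine List.mem_ofFn.2 ⟨finFunctionFinEquiv fun j => ⟨d j, hd j⟩, ?_⟩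
  funext j
  set t := finFunctionFinEquiv fun j => (⟨d j, hd j⟩ : Fin ((N + 1) * k)) with ht
  have : (t : ℕ) / ((N + 1) * k) ^ (j : ℕ) % ((N + 1) * k) = d j := by
    rw [← finFunctionFinEquiv_symm_apply_val, ht, Equiv.symm_apply_apply]
  rw [h.out t t.2 j j.2, this]

end Input

/-! ## Choosing candidates -/

theorem Near.exists_le {O : Oracle} {k : ℕ} {A : ℕ → ℕ} {off s f : ℕ} (hk : 0 < k)
    (h : Near O k A off s) (hf : O.isFacility f) :
    ∃ r < k, O.dist (A (off + r)) s ≤ O.dist f s := by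
  rcases h.2 f hf with ⟨r, hr, e⟩ | ⟨-, h2⟩
  · exact ⟨r, hr, by rw [e]⟩
  · exact ⟨0, hk, h2 0 hk⟩

/-- Distinct facilities can be replaced by distinct candidates that are at least as near. -/
theorem exists_injective_candidates {O : Oracle} {k : ℕ} {A : ℕ → ℕ} {off s f : Fin k → ℕ}
    (h : ∀ i, Near O k A (off i) (s i)) (hf : ∀ i, O.isFacility (f i))
    (hinj : Function.Injective f) :
    ∃ r : Fin k → ℕ, (∀ i, r i < k) ∧
      (∀ i, O.dist (A (off i + r i)) (s i) ≤ O.dist (f i) (s i)) ∧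
      Function.Injective fun i => A (off i + r i) := by
  classical
  set T : Fin k → Finset ℕ := fun i => (Finset.range k).image fun r => A (off i + r) with hT
  -- A listed facility is kept. A facility that is not listed may be replaced by any entry of its
  -- list, which then has `k` distinct entries.
  set t : Fin k → Finset ℕ := fun i => if f i ∈ T i then {f i} else T i with ht
  have hmem : ∀ i x, x ∈ T i ↔ ∃ r < k, A (off i + r) = x := by
    intro i x
    simp [hT]
  have hnot : ∀ i, f i ∉ T i → (T i).card = k ∧ ∀ x ∈ T i, O.dist x (s i) ≤ O.dist (f i) (s i) := by
    intro i hi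
    rw [hmem] at hi
    obtain ⟨h1, h2⟩ := ((h i).2 (f i) (hf i)).resolve_left hi
    refine ⟨?_, fun x hx => ?_⟩
    · rw [hT, Finset.card_image_of_injOn, Finset.card_range]
      intro a ha b hb e
      exact h1 a (by simpa using ha) b (by simpa using hb) e
    · obtain ⟨r, hr, rfl⟩ := (hmem i x).1 hx
      exact h2 r hr
  -- Hall's condition: one full list already has `k` elements, and without a full list the
  -- singletons are distinct because `f` is injective.
  have hHall : ∀ J : Finset (Fin k), J.card ≤ (J.biUnion t).card := by
    intro J
    by_cases hJ : ∃ i ∈ J, f i ∉ T i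
    · obtain ⟨i, hi, hiT⟩ := hJ
      calc J.card ≤ k := by simpa using Finset.card_le_univ J
        _ = (t i).card := by rw [ht]; simp only [if_neg hiT]; exact (hnot i hiT).1.symm
        _ ≤ _ := Finset.card_le_card (Finset.subset_biUnion_of_mem t hi)
    · push Not at hJ
      calc J.card = (J.image f).card := (Finset.card_image_of_injective _ hinj).symm
        _ ≤ _ := by
          refine Finset.card_le_card fun x hx => ?_
          obtain ⟨i, hi, rfl⟩ := Finset.mem_image.1 hx
          refine Finset.mem_biUnion.2 ⟨i, hi, ?_⟩
          simp [ht, hJ i hi]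
  obtain ⟨g, hg, hgt⟩ := (Finset.all_card_le_biUnion_card_iff_exists_injective t).1 hHall
  have hgood : ∀ i, ∃ r < k, A (off i + r) = g i ∧ O.dist (g i) (s i) ≤ O.dist (f i) (s i) := by
    intro i
    have hi := hgt i
    by_cases hiT : f i ∈ T i
    · simp only [ht, if_pos hiT, Finset.mem_singleton] at hi
      obtain ⟨r, hr, e⟩ := (hmem i _).1 hiT
      exact ⟨r, hr, by rw [e, hi], by rw [hi]⟩
    · simp only [ht, if_neg hiT] at hi
      obtain ⟨r, hr, e⟩ := (hmem i _).1 hi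
      exact ⟨r, hr, e, (hnot i hiT).2 _ hi⟩
  choose r hr e hle using hgood
  refine ⟨r, hr, fun i => by rw [e]; exact hle i, ?_⟩
  simpa only [e] using hg

/-! ## Costs -/

section Cost

variable {X : Type*} [MetricSpace X]

/-- Since d(c,f) ≤ 2d(s,c), moving the centre adds at most 2|A|d(s,c) ≤ 2(1+ε/4)z + (ε/2)M to the
cost z. -/
theorem clusterCost_le_of_serves {pt : ℕ → X} {ε M : ℝ} (hε : 0 < ε) {A : Finset ℕ} {c f : X}
    {s : ℕ} (hM : idxCost pt A c ≤ M) (hs : Serves pt (ε / 4) M A c s)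
    (hf : dist f (pt s) ≤ dist c (pt s)) : idxCost pt A f ≤ (3 + ε) * M := by
  have h1 : idxCost pt A f ≤ idxCost pt A c + A.card * (2 * dist (pt s) c) := by
    calc idxCost pt A f ≤ ∑ x ∈ A, (dist (pt x) c + 2 * dist (pt s) c) := by
          refine Finset.sum_le_sum fun x _ => ?_
          have t1 := dist_triangle (pt x) c f
          have t2 := dist_triangle_right c f (pt s)
          rw [dist_comm c (pt s)] at hf t2
          linarith
      _ = _ := by rw [Finset.sum_add_distrib, Finset.sum_const, nsmul_eq_mul]; rfl
  have h0 := idxCost_nonneg pt A c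
  unfold Serves at hs
  nlinarith

theorem minLoadCost_le {k : ℕ} (hk : 0 < k) {C : Fin k → X} {O : Fin k → Finset X} {B : ℝ}
    (h : ∀ i, clusterCost (C i) (O i) ≤ B) : minLoadCost C O ≤ B := by
  have : Nonempty (Fin k) := ⟨⟨0, hk⟩⟩
  refine (ciInf_le (Set.finite_range _).bddBelow (1 : Equiv.Perm (Fin k))).trans ?_
  exact ciSup_le fun j => h j

theorem exists_optClusterCost {F : Finset X} (hF : F.Nonempty) (O : Finset X) :
    ∃ c ∈ F, clusterCost c O = optClusterCost F O := by
  have : Nonempty {c // c ∈ F} := hF.to_subtype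
  obtain ⟨c, hc⟩ := exists_eq_ciInf_of_finite (f := fun c : {c // c ∈ F} => clusterCost c.1 O)
  exact ⟨c.1, c.2, hc⟩

/-- Reindexing the optimal centres by the inverse of the optimal permutation assigns centre `i` to
cluster `i`, which removes the permutation from the analysis. -/
theorem exists_optClusteringCost {F : Finset X} {k : ℕ} (hkF : k ≤ F.card)
    (O : Fin k → Finset X) : ∃ C : Fin k → X, Function.Injective C ∧ (∀ i, C i ∈ F) ∧
      ∀ i, clusterCost (C i) (O i) ≤ optClusteringCost F O := by
  classical
  have : Finite {C : Fin k → X // Function.Injective C ∧ ∀ j, C j ∈ F} := by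
    refine Finite.of_injective (β := Fin k → {x // x ∈ F})
      (fun C j => ⟨C.1 j, C.2.2 j⟩) fun C C' h => ?_
    refine Subtype.ext (funext fun j => ?_)
    simpa using congrFun h j
  have : Nonempty {C : Fin k → X // Function.Injective C ∧ ∀ j, C j ∈ F} := by
    obtain ⟨e⟩ := Function.Embedding.nonempty_of_card_le (α := Fin k) (β := {x // x ∈ F})
      (by simpa using hkF)
    exact ⟨⟨fun j => e j, fun i j h => e.injective (Subtype.ext h), fun j => (e j).2⟩⟩
  obtain ⟨C, hC⟩ := exists_eq_ciInf_of_finite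
    (f := fun C : {C : Fin k → X // Function.Injective C ∧ ∀ j, C j ∈ F} => minLoadCost C.1 O)
  obtain ⟨π, hπ⟩ := exists_eq_ciInf_of_finite
    (f := fun π : Equiv.Perm (Fin k) => ⨆ j : Fin k, clusterCost (C.1 j) (O (π j)))
  refine ⟨fun i => C.1 (π.symm i), C.2.1.comp π.symm.injective, fun i => C.2.2 _, fun i => ?_⟩
  have h1 : optClusteringCost F O = ⨆ j : Fin k, clusterCost (C.1 j) (O (π j)) := by
    rw [hπ]
    exact hC.symm
  rw [h1]
  have := le_ciSup (f := fun j : Fin k => clusterCost (C.1 j) (O (π j)))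
    (Set.finite_range _).bddAbove (π.symm i)
  simpa using this

end Cost

/-! ## Time bounds -/

theorem exists_time_constant : ∃ c : ℕ, ∀ (n k : ℕ) (ε : ℝ), 0 < n → 0 < k → 0 < ε → ε < 1 →
    (timeBound n k (numRounds k ε) : ℝ) ≤ c * ((k : ℝ) / ε) ^ (c * k) * n ∧
    ((((numRounds k ε + 1) * k) ^ k : ℕ) : ℝ) ≤ c * ((k : ℝ) / ε) ^ (c * k) := by
  obtain ⟨c, hc⟩ : ∃ c : ℕ, c = 156 * 4610 ^ 2 := ⟨_, rfl⟩
  have hc' : (c : ℝ) = 156 * 4610 ^ 2 := by rw [hc]; norm_num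
  refine ⟨c, fun n k ε hn hk hε hε1 => ?_⟩
  have hk' : (1 : ℝ) ≤ k := by exact_mod_cast hk
  set x := (k : ℝ) / ε with hx
  have hkx : (k : ℝ) ≤ x := by
    rw [hx, le_div_iff₀ hε]
    nlinarith
  have hx1 : 1 ≤ x := hk'.trans hkx
  set N := numRounds k ε with hN
  have hNx : (N : ℝ) + 1 ≤ 4610 * x ^ 2 := by
    have h1 : (N : ℝ) < 4608 * (k : ℝ) ^ 2 / ε ^ 2 + 1 := Nat.ceil_lt_add_one (by positivity)
    have h2 : 4608 * (k : ℝ) ^ 2 / ε ^ 2 = 4608 * x ^ 2 := by rw [hx]; ring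
    have h3 : 1 ≤ x ^ 2 := one_le_pow₀ hx1
    linarith
  set Q := (N + 1) * k with hQ
  have hQx : (Q : ℝ) ≤ 4610 * x ^ 3 := by
    rw [hQ]
    push_cast
    calc ((N : ℝ) + 1) * k ≤ 4610 * x ^ 2 * x := by gcongr
      _ = _ := by ring
  -- For `k = 1` the ratio `x` may be close to 1, so the constant stays outside; for `k ≥ 2` one has
  -- `x ≥ 2` and 4610 ≤ 2^13.
  have hconst : (4610 : ℝ) ^ k ≤ 4610 * x ^ (13 * k) := by
    rcases Nat.lt_or_ge k 2 with h | h
    · obtain rfl : k = 1 := by omega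
      rw [pow_one]
      exact le_mul_of_one_le_right (by norm_num) (one_le_pow₀ hx1)
    · have hx2 : 2 ≤ x := le_trans (by exact_mod_cast h) hkx
      calc (4610 : ℝ) ^ k ≤ (2 ^ 13) ^ k := pow_le_pow_left₀ (by norm_num) (by norm_num) _
        _ ≤ (x ^ 13) ^ k := by gcongr
        _ = x ^ (13 * k) := (pow_mul _ _ _).symm
        _ ≤ _ := le_mul_of_one_le_left (by positivity) (by norm_num)
  set Z := Q ^ k with hZ
  have hZx : (Z : ℝ) ≤ 4610 * x ^ (16 * k) := by
    rw [hZ]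
    push_cast
    calc (Q : ℝ) ^ k ≤ (4610 * x ^ 3) ^ k := by gcongr
      _ = 4610 ^ k * x ^ (3 * k) := by rw [mul_pow, ← pow_mul]
      _ ≤ 4610 * x ^ (13 * k) * x ^ (3 * k) := by gcongr
      _ = _ := by rw [mul_assoc, ← pow_add]; congr 2; ring
  have hexp : ∀ e ≤ 32, x ^ (e * k) ≤ x ^ (c * k) := fun e he =>
    pow_le_pow_right₀ hx1 (Nat.mul_le_mul_right _ (he.trans (by omega)))
  have hQ1 : 1 ≤ Q := Nat.succ_le_of_lt (by positivity)
  have hNQ : N + 1 ≤ Q := Nat.le_mul_of_pos_right _ hk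
  have hkQ : k ≤ Q := Nat.le_mul_of_pos_left _ (by omega)
  have hQZ : Q ≤ Z := Nat.le_self_pow hk.ne' Q
  constructor
  -- The constant is 38 + 10 + 28 + 26 + 54, one summand for each of `a1` to `a5`.
  · have hT : timeBound n k N ≤ 156 * Z ^ 2 * n := by
      unfold timeBound
      rw [← hQ, ← hZ]
      have a1 : N * (n * 16 + 22) ≤ 38 * (Q * n) := by nlinarith
      have a2 : n * 10 ≤ 10 * (Q * n) := by nlinarith
      have a3 : (N + 1) * (k * (n * 8 + 14) + 6) ≤ 28 * (Q * n) := by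
        have : (N + 1) * (k * (n * 8 + 14) + 6) = Q * (n * 8 + 14) + (N + 1) * 6 := by
          rw [hQ]; ring
        rw [this]
        nlinarith
      have a4 : Z * (k * 8 + 18) ≤ 26 * (Z * Q) := by nlinarith
      have a5 : k * 4 + 50 ≤ 54 * (Q * n) := by nlinarith
      have a6 : Q * n ≤ Z ^ 2 * n := Nat.mul_le_mul_right _ (by nlinarith)
      have a7 : Z * Q ≤ Z ^ 2 * n := by
        calc Z * Q ≤ Z * Z := Nat.mul_le_mul_left _ hQZ
          _ = Z ^ 2 := (sq Z).symm
          _ ≤ _ := Nat.le_mul_of_pos_right _ hn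
      have : 156 * Z ^ 2 * n = 156 * (Z ^ 2 * n) := by ring
      omega
    have hT' : (timeBound n k N : ℝ) ≤ 156 * (Z : ℝ) ^ 2 * n := by exact_mod_cast hT
    refine hT'.trans (mul_le_mul_of_nonneg_right ?_ (Nat.cast_nonneg n))
    calc 156 * (Z : ℝ) ^ 2 ≤ 156 * (4610 * x ^ (16 * k)) ^ 2 := by gcongr
      _ = 156 * 4610 ^ 2 * x ^ (32 * k) := by
        rw [mul_pow, ← pow_mul, ← mul_assoc]
        congr 2
        ring
      _ ≤ _ := by
        rw [hc']
        exact mul_le_mul_of_nonneg_left (hexp 32 le_rfl) (by norm_num)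
  · refine hZx.trans ?_
    have := hexp 16 (by norm_num)
    rw [hc']
    exact mul_le_mul (by norm_num) this (by positivity) (by norm_num)

/-! ### From served clusters to a good tuple -/

section Output

variable {X : Type*} [MetricSpace X] [DecidableEq X] {P F : Finset X}
  {pts : Fin (P ∪ F).card ≃ {x // x ∈ P ∪ F}} {x₀ : X} {k N : ℕ} {σ : State}

/-- Every cluster is served by one of the points in `S`. -/
def AllServed (pts : Fin (P ∪ F).card ≃ {x // x ∈ P ∪ F}) (x₀ : X) {k : ℕ} (ε M : ℝ)
    (O : Fin k → Finset X) (c : Fin k → X) (S : Finset ℕ) : Prop :=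
  ∀ i, ∃ s ∈ S, Serves (point pts x₀) (ε / 4) M (indices pts x₀ (O i)) (c i) s

theorem likely_allServed (pts : Fin (P ∪ F).card ≃ {x // x ∈ P ∪ F}) (x₀ : X) {ε : ℝ}
    (hF : F.Nonempty) (hk : 0 < k) (hε : 0 < ε) (hε1 : ε < 1) {O : Fin k → Finset X}
    (hO : IsPartition P O) {c : Fin k → X} {M : ℝ} (hM : ∀ i, clusterCost (c i) (O i) ≤ M) :
    Likely (inputOracle P F pts)
      {cfg | cfg.1 = [] ∧ Finished (inputOracle P F pts) (P ∪ F).card k (numRounds k ε) cfg.2 ∧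
        AllServed pts x₀ ε M O c (sampleSet (numRounds k ε) cfg.2)}
      (timeBound (P ∪ F).card k (numRounds k ε)) ([program], initState (P ∪ F).card k ε)
      (1 / 2) := by
  obtain ⟨f, hf⟩ := hF
  have hfu : f ∈ P ∪ F := Finset.mem_union_right _ hf
  obtain ⟨i, hi, hif⟩ := exists_point pts x₀ hfu
  refine (likely_program (inputOracle_dist_nonneg pts) (Finset.card_pos.2 ⟨f, hfu⟩) hk hε
    (fun x hx => ((inputOracle_isFacility pts x₀).1 hx).1)
    ⟨i, (inputOracle_isFacility pts x₀).2 ⟨hi, by rwa [hif]⟩⟩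
    (isPotential_failBound pts x₀ hk hε hε1 hO hM) ?_ ?_).mono le_rfl ?_
  · intro S
    simp only [failBound, pow_zero, mul_one]
    split_ifs <;> positivity
  · intro S hS
    have hne : (unserved (point pts x₀) (ε / 4) M (fun i => indices pts x₀ (O i)) c S).card ≠ 0 := by
      intro h0
      refine hS fun i => ?_
      by_contra hi
      push Not at hi
      have := Finset.card_eq_zero.1 h0 ▸ mem_unserved.2 (show Unserved (point pts x₀) (ε / 4) M
        (indices pts x₀ (O i)) (c i) S from hi)
      simp at this
    simp only [failBound, if_neg hne, pow_zero, mul_one]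
    -- With no rounds left, any unserved cluster makes the potential 2^u ≥ 1.
    exact one_le_pow₀ (by norm_num)
  · have := failBound_numRounds_le hk hε hε1 (u := (unserved (point pts x₀) (ε / 4) M
      (fun i => indices pts x₀ (O i)) c {0}).card)
      ((Finset.card_le_univ _).trans (by simp))
    linarith

theorem Finished.minLoadCost_le {ε M : ℝ} (hk : 0 < k) (hε : 0 < ε)
    (h : Finished (inputOracle P F pts) (P ∪ F).card k N σ) {O : Fin k → Finset X}
    (hO : IsPartition P O) {g ι r : Fin k → ℕ}
    (hg : ∀ i, (inputOracle P F pts).isFacility (g i))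
    (hM : ∀ i, clusterCost (point pts x₀ (g i)) (O i) ≤ M) (hι : ∀ i, ι i ≤ N)
    (hs : ∀ i, Serves (point pts x₀) (ε / 4) M (indices pts x₀ (O i)) (point pts x₀ (g i))
      (σ.narr 1 (ι i))) (hr : ∀ i, r i < k)
    (hle : ∀ i, (inputOracle P F pts).dist (σ.narr 2 (ι i * k + r i)) (σ.narr 1 (ι i)) ≤
      (inputOracle P F pts).dist (g i) (σ.narr 1 (ι i))) :
    (fun i => point pts x₀ (σ.narr 2 (ι i * k + r i))) ∈ outputList pts x₀ k N σ ∧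
      minLoadCost (fun i => point pts x₀ (σ.narr 2 (ι i * k + r i))) O ≤ (3 + ε) * M := by
  have hlt : ∀ i, ι i * k + r i < (N + 1) * k := by
    intro i
    calc ι i * k + r i < (ι i + 1) * k := by rw [add_mul (ι i) 1, one_mul]; have := hr i; omega
      _ ≤ _ := Nat.mul_le_mul_right _ (by have := hι i; omega)
  refine ⟨h.mem_outputList x₀ (fun i => ι i * k + r i) hlt, MinLoad.minLoadCost_le hk fun i => ?_⟩
  rw [← idxCost_indices pts x₀ (hO.subset i)]
  refine clusterCost_le_of_serves hε (c := point pts x₀ (g i)) ?_ (hs i) ?_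
  · rw [idxCost_indices pts x₀ (hO.subset i)]
    exact hM i
  · have hsn := h.samples (ι i) (by have := hι i; omega)
    have := hle i
    rwa [inputOracle_dist pts x₀ ((inputOracle_isFacility pts x₀).1 (h.isFacility hk (hlt i))).1 hsn,
      inputOracle_dist pts x₀ ((inputOracle_isFacility pts x₀).1 (hg i)).1 hsn] at this

theorem Finished.exists_tuple {ε M : ℝ} (hk : 0 < k) (hε : 0 < ε)
    (h : Finished (inputOracle P F pts) (P ∪ F).card k N σ) {O : Fin k → Finset X}
    (hO : IsPartition P O) {c : Fin k → X} (hc : ∀ i, c i ∈ F)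
    (hM : ∀ i, clusterCost (c i) (O i) ≤ M)
    (hs : AllServed pts x₀ ε M O c (sampleSet N σ)) :
    (∃ C ∈ outputList pts x₀ k N σ, minLoadCost C O ≤ (3 + ε) * M) ∧
    (Function.Injective c → ∃ C ∈ outputList pts x₀ k N σ, Function.Injective C ∧
      minLoadCost C O ≤ (3 + ε) * M) := by
  choose g hgn hg using fun i => exists_point pts x₀ (Finset.mem_union_right P (hc i))
  obtain rfl : (fun i => point pts x₀ (g i)) = c := funext hg
  have hgf : ∀ i, (inputOracle P F pts).isFacility (g i) := fun i =>
    (inputOracle_isFacility pts x₀).2 ⟨hgn i, hc i⟩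
  have hs' : ∀ i, ∃ j ≤ N, Serves (point pts x₀) (ε / 4) M (indices pts x₀ (O i))
      (point pts x₀ (g i)) (σ.narr 1 j) := by
    intro i
    obtain ⟨s, hsS, hsv⟩ := hs i
    obtain ⟨j, hj, rfl⟩ := mem_sampleSet.1 hsS
    exact ⟨j, hj, hsv⟩
  choose ι hι hserve using hs'
  have hnear := fun i => h.near (ι i) (by have := hι i; omega)
  constructor
  · choose r hr hle using fun i => (hnear i).exists_le hk (hgf i)
    exact ⟨_, h.minLoadCost_le hk hε hO hgf hM hι hserve hr hle⟩
  · intro hinj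
    have hginj : Function.Injective g := fun i j e => hinj (by simp only [e])
    obtain ⟨r, hr, hle, hrinj⟩ := exists_injective_candidates hnear hgf hginj
    obtain ⟨hmem, hcost⟩ := h.minLoadCost_le hk hε hO hgf hM hι hserve hr hle
    refine ⟨_, hmem, fun i j e => hrinj ?_, hcost⟩
    have hlt : ∀ i, σ.narr 2 (ι i * k + r i) < (P ∪ F).card := fun i =>
      ((inputOracle_isFacility pts x₀).1 ((hnear i).1 (r i) (hr i))).1
    exact point_injOn pts x₀ (hlt i) (hlt j) e

end Output

end MinLoad

open MinLoad in
theorem mainTheorem4 :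
    ∃ (prog : Prog) (c : ℕ),
      ∀ (X : Type*) [MetricSpace X] [DecidableEq X] (P F : Finset X)
        (pts : Fin (P ∪ F).card ≃ {x // x ∈ P ∪ F}) (k : ℕ) (ε : ℝ),
        F.Nonempty → 0 < k → 0 < ε → ε < 1 →
        ∃ T : ℕ,
          (T : ℝ) ≤ c * ((k : ℝ) / ε) ^ (c * k) * ((P ∪ F).card : ℝ) ∧
          (∀ cfg ∈ (runInput prog P F pts k ε T).support,
            cfg.1 = [] ∧
            ∃ L : List (Fin k → X), Encodes pts cfg.2 L ∧
              (∀ C ∈ L, ∀ j, C j ∈ F) ∧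
              (L.length : ℝ) ≤ c * ((k : ℝ) / ε) ^ (c * k)) ∧
          ∀ O : Fin k → Finset X, IsPartition P O →
            1 / 2 ≤ (runInput prog P F pts k ε T).toOuterMeasure
              {cfg | ∃ L : List (Fin k → X), Encodes pts cfg.2 L ∧
                ∃ C ∈ L, minLoadCost C O ≤ (3 + ε) * ⨆ i, optClusterCost F (O i)} ∧
            (k ≤ F.card →
              1 / 2 ≤ (runInput prog P F pts k ε T).toOuterMeasure
                {cfg | ∃ L : List (Fin k → X), Encodes pts cfg.2 L ∧
                  ∃ C ∈ L, Function.Injective C ∧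
                    minLoadCost C O ≤ (3 + ε) * optClusteringCost F O}) := by
  obtain ⟨c, hc⟩ := exists_time_constant
  refine ⟨program, c, fun X _ _ P F pts k ε hF hk hε hε1 => ?_⟩
  obtain ⟨x₀, hx₀⟩ := id hF
  have hx₀u : x₀ ∈ P ∪ F := Finset.mem_union_right _ hx₀
  have hn : 0 < (P ∪ F).card := Finset.card_pos.2 ⟨x₀, hx₀u⟩
  obtain ⟨hT, hL⟩ := hc (P ∪ F).card k ε hn hk hε hε1
  refine ⟨timeBound (P ∪ F).card k (numRounds k ε), hT, ?_, ?_⟩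
  · obtain ⟨i, hi, hif⟩ := exists_point pts x₀ hx₀u
    have hsafe := likely_program (inputOracle_dist_nonneg pts) hn hk hε
      (fun x hx => ((inputOracle_isFacility pts x₀).1 hx).1)
      ⟨i, (inputOracle_isFacility pts x₀).2 ⟨hi, by rwa [hif]⟩⟩
      -- With zero potential and a trivial goal, the probabilistic analysis yields halting in time
      -- with a well-formed output for every sequence of draws.
      (Φ := fun _ _ => 0) (G := fun _ => True)
      (fun _ _ _ _ _ _ _ _ => by simp) (fun _ => le_rfl) (fun _ h => absurd trivial h)
    rw [sub_zero] at hsafe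
    intro cfg hcfg
    obtain ⟨h1, h2, -⟩ := support_subset_of_likely hsafe hcfg
    refine ⟨h1, outputList pts x₀ k _ cfg.2, h2.encodes x₀ hk, h2.mem_facilities x₀ hk, ?_⟩
    rw [outputList, List.length_ofFn]
    exact hL
  · intro O hO
    constructor
    -- Optimal centres of the single clusters may coincide; the analysis needs only the common load
    -- bound.
    · choose ctr hctr hcost using fun i => exists_optClusterCost hF (O i)
      have hM : ∀ i, clusterCost (ctr i) (O i) ≤ ⨆ i, optClusterCost F (O i) := fun i => by
        rw [hcost]
        exact le_ciSup (f := fun i => optClusterCost F (O i)) (Set.finite_range _).bddAbove i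
      refine (half_le_of_likely (likely_allServed pts x₀ hF hk hε hε1 hO hM)).trans
        (MeasureTheory.measure_mono ?_)
      rintro cfg ⟨-, h2, h3⟩
      exact ⟨_, h2.encodes x₀ hk, (h2.exists_tuple hk hε hO hctr hM h3).1⟩
    · intro hkF
      obtain ⟨ctr, hinj, hctr, hM⟩ := exists_optClusteringCost hkF O
      refine (half_le_of_likely (likely_allServed pts x₀ hF hk hε hε1 hO hM)).trans
        (MeasureTheory.measure_mono ?_)
      rintro cfg ⟨-, h2, h3⟩
      exact ⟨_, h2.encodes x₀ hk, (h2.exists_tuple hk hε hO hctr hM h3).2 hinj⟩
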